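/- Let $\mathfrak g=\mathfrak{sl}_6(\mathbb C)$ be the Lie algebra of traceless complex $6\times 6$ matrices, with Cartan subalgebra $\mathfrak h$ the diagonal matrices in $\mathfrak g$ and with $\mathfrak n_+$ the strictly upper triangular matrices. Let $E_{i,j}$ be the matrix units, and put $e_{i,j}=E_{i,j}$, $f_{i,j}=E_{j,i}$ for $1\le i<j\le 6$ and $h_i=E_{i,i}-E_{i+1,i+1}$ for $1\le i\le 5$. Let $v'$ be the following element of the universal enveloping algebra $\mathcal U(\mathfrak g)$: $$\begin{aligned} v'={}&\frac{7}{2} e_{1,5} e_{2,6} - \frac{7}{2} e_{1,6} e_{2,5} - \frac{4}{3} e_{1,2} e_{2,5} e_{2,6} \\ & + \frac{1}{3} e_{1,3} e_{2,5} e_{3,6} - \frac{5}{3} e_{1,3} e_{2,6} e_{3,5} \\ & + \frac{5}{3} e_{1,4} e_{2,5} e_{4,6} - 3 e_{1,4} e_{2,6} e_{4,5} - \frac{1}{3} e_{1,5} e_{2,3} e_{3,6} \\ & - \frac{5}{3} e_{1,5} e_{2,4} e_{4,6} + \frac{5}{3} e_{1,6} e_{2,3} e_{3,5} + 3 e_{1,6}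 e_{2,4} e_{4,5} \\ & + \frac{4}{3} f_{1,2} e_{1,5} e_{1,6} - h_1 e_{1,5} e_{2,6} - \frac{1}{3} h_1 e_{1,6} e_{2,5} \\ & - \frac{4}{15} h_2 e_{1,5} e_{2,6} + \frac{4}{15} h_2 e_{1,6} e_{2,5} + \frac{8}{15} h_3 e_{1,5} e_{2,6} \\ & - \frac{8}{15} h_3 e_{1,6} e_{2,5} + \frac{12}{5} h_4 e_{1,5} e_{2,6} - \frac{12}{5} h_4 e_{1,6} e_{2,5} \\ & + h_5 e_{1,5} e_{2,6} - h_5 e_{1,6} e_{2,5} + \frac{2}{3} e_{1,2} e_{2,3} e_{2,5} e_{3,6} \\ & - \frac{2}{3} e_{1,2} e_{2,3} e_{2,6} e_{3,5} + \frac{2}{3} e_{1,2} e_{2,4} e_{2,5} e_{4,6} \\ & - \frac{2}{3} e_{1,2} e_{2,4} e_{2,6} e_{4,5} + \frac{2}{3} e_{1,2} e_{2,5}^2 e_{5,6} \\ & + 2 e_{1,3} e_{2,4} e_{3,5} e_{4,6} - 2 e_{1,3} e_{2,4} e_{3,6} e_{4,5} \\ & - \frac{4}{3} e_{1,3} e_{2,5}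 e_{3,4} e_{4,6} + \frac{2}{3} e_{1,3} e_{2,5} e_{3,5} e_{5,6} \\ & + \frac{4}{3} e_{1,3} e_{2,6} e_{3,4} e_{4,5} - 2 e_{1,4} e_{2,3} e_{3,5} e_{4,6} \\ & + 2 e_{1,4} e_{2,3} e_{3,6} e_{4,5} + \frac{2}{3} e_{1,4} e_{2,5} e_{4,5} e_{5,6} \\ & + \frac{4}{3} e_{1,5} e_{2,3} e_{3,4} e_{4,6} - \frac{2}{3} e_{1,5} e_{2,3} e_{3,5} e_{5,6} \\ & - \frac{2}{3} e_{1,5} e_{2,4} e_{4,5} e_{5,6} - \frac{4}{3} e_{1,6} e_{2,3} e_{3,4} e_{4,5} \\ & - \frac{2}{5} f_{1,2} e_{1,2} e_{1,5} e_{2,6} + \frac{2}{5} f_{1,2} e_{1,2} e_{1,6} e_{2,5} \\ & - \frac{2}{3} f_{1,2} e_{1,3} e_{1,5} e_{3,6} + \frac{2}{3} f_{1,2} e_{1,3} e_{1,6} e_{3,5} \\ & - \frac{2}{3} f_{1,2} e_{1,4} e_{1,5} e_{4,6} + \frac{2}{3} f_{1,2} e_{1,4} e_{1,6} e_{4,5}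 \\ & - \frac{2}{3} f_{1,2} e_{1,5}^2 e_{5,6} + \frac{4}{15} f_{1,3} e_{1,3} e_{1,5} e_{2,6} \\ & - \frac{4}{15} f_{1,3} e_{1,3} e_{1,6} e_{2,5} + \frac{4}{15} f_{1,4} e_{1,4} e_{1,5} e_{2,6} \\ & - \frac{4}{15} f_{1,4} e_{1,4} e_{1,6} e_{2,5} + \frac{4}{15} f_{1,5} e_{1,5}^2 e_{2,6} \\ & - \frac{4}{15} f_{1,5} e_{1,5} e_{1,6} e_{2,5} + \frac{4}{15} f_{1,6} e_{1,5} e_{1,6} e_{2,6} \\ & - \frac{4}{15} f_{1,6} e_{1,6}^2 e_{2,5} + \frac{4}{15} f_{2,3} e_{1,5} e_{2,3} e_{2,6} \\ & - \frac{4}{15} f_{2,3} e_{1,6} e_{2,3} e_{2,5} + \frac{4}{15} f_{2,4} e_{1,5} e_{2,4} e_{2,6} \\ & - \frac{4}{15} f_{2,4} e_{1,6} e_{2,4} e_{2,5} + \frac{4}{15} f_{2,5} e_{1,5} e_{2,5} e_{2,6} \\ & - \frac{4}{15} f_{2,5} e_{1,6} e_{2,5}^2 + \frac{4}{15} f_{2,6}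 e_{1,5} e_{2,6}^2 \\ & - \frac{4}{15} f_{2,6} e_{1,6} e_{2,5} e_{2,6} - \frac{4}{3} f_{3,4} e_{1,4} e_{2,5} e_{3,6} \\ & + \frac{4}{3} f_{3,4} e_{1,4} e_{2,6} e_{3,5} + \frac{4}{3} f_{3,4} e_{1,5} e_{2,4} e_{3,6} \\ & - \frac{16}{15} f_{3,4} e_{1,5} e_{2,6} e_{3,4} - \frac{4}{3} f_{3,4} e_{1,6} e_{2,4} e_{3,5} \\ & + \frac{16}{15} f_{3,4} e_{1,6} e_{2,5} e_{3,4} + \frac{4}{15} f_{3,5} e_{1,5} e_{2,6} e_{3,5} \\ & - \frac{4}{15} f_{3,5} e_{1,6} e_{2,5} e_{3,5} + \frac{4}{15} f_{3,6} e_{1,5} e_{2,6} e_{3,6} \\ & - \frac{4}{15} f_{3,6} e_{1,6} e_{2,5} e_{3,6} + \frac{4}{15} f_{4,5} e_{1,5} e_{2,6} e_{4,5} \\ & - \frac{4}{15} f_{4,5} e_{1,6} e_{2,5} e_{4,5} + \frac{4}{15} f_{4,6} e_{1,5} e_{2,6} e_{4,6} \\ & - \frac{4}{15} f_{4,6} e_{1,6}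 e_{2,5} e_{4,6} - \frac{2}{3} f_{5,6} e_{1,2} e_{2,6}^2 \\ & - \frac{2}{3} f_{5,6} e_{1,3} e_{2,6} e_{3,6} - \frac{2}{3} f_{5,6} e_{1,4} e_{2,6} e_{4,6} \\ & - \frac{2}{5} f_{5,6} e_{1,5} e_{2,6} e_{5,6} + \frac{2}{3} f_{5,6} e_{1,6} e_{2,3} e_{3,6} \\ & + \frac{2}{3} f_{5,6} e_{1,6} e_{2,4} e_{4,6} + \frac{2}{5} f_{5,6} e_{1,6} e_{2,5} e_{5,6} \\ & + \frac{2}{3} f_{5,6} f_{1,2} e_{1,6}^2 + \frac{2}{3} h_1 e_{1,5} e_{2,3} e_{3,6} \\ & + \frac{2}{3} h_1 e_{1,5} e_{2,4} e_{4,6} + \frac{2}{3} h_1 e_{1,5} e_{2,5} e_{5,6} \\ & - \frac{2}{3} h_1 e_{1,6} e_{2,3} e_{3,5} - \frac{2}{3} h_1 e_{1,6} e_{2,4} e_{4,5} \\ & - \frac{2}{3} h_1 f_{5,6} e_{1,6} e_{2,6} + \frac{2}{5} h_1 h_2 e_{1,5} e_{2,6} \\ & - \frac{2}{5} h_1 h_2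 e_{1,6} e_{2,5} + \frac{2}{15} h_1 h_3 e_{1,5} e_{2,6} \\ & - \frac{2}{15} h_1 h_3 e_{1,6} e_{2,5} - \frac{2}{15} h_1 h_4 e_{1,5} e_{2,6} \\ & + \frac{2}{15} h_1 h_4 e_{1,6} e_{2,5} - \frac{2}{5} h_1 h_5 e_{1,5} e_{2,6} \\ & - \frac{4}{15} h_1 h_5 e_{1,6} e_{2,5} - \frac{2}{3} h_2 e_{1,3} e_{2,5} e_{3,6} \\ & + \frac{2}{3} h_2 e_{1,3} e_{2,6} e_{3,5} - \frac{2}{3} h_2 e_{1,4} e_{2,5} e_{4,6} \\ & + \frac{2}{3} h_2 e_{1,4} e_{2,6} e_{4,5} + \frac{2}{3} h_2 e_{1,5} e_{2,3} e_{3,6} \\ & + \frac{2}{3} h_2 e_{1,5} e_{2,4} e_{4,6} - \frac{2}{3} h_2 e_{1,6} e_{2,3} e_{3,5} \\ & - \frac{2}{3} h_2 e_{1,6} e_{2,4} e_{4,5} + \frac{2}{5} h_2 h_2 e_{1,5} e_{2,6} \\ & - \frac{2}{5} h_2 h_2 e_{1,6} e_{2,5} + \frac{4}{15} h_2 h_3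 e_{1,5} e_{2,6} \\ & - \frac{4}{15} h_2 h_3 e_{1,6} e_{2,5} - \frac{4}{15} h_2 h_4 e_{1,5} e_{2,6} \\ & + \frac{4}{15} h_2 h_4 e_{1,6} e_{2,5} - \frac{2}{15} h_2 h_5 e_{1,5} e_{2,6} \\ & + \frac{2}{15} h_2 h_5 e_{1,6} e_{2,5} - \frac{2}{3} h_3 e_{1,3} e_{2,5} e_{3,6} \\ & + \frac{2}{3} h_3 e_{1,3} e_{2,6} e_{3,5} + \frac{2}{3} h_3 e_{1,4} e_{2,5} e_{4,6} \\ & - \frac{2}{3} h_3 e_{1,4} e_{2,6} e_{4,5} + \frac{2}{3} h_3 e_{1,5} e_{2,3} e_{3,6} \\ & - \frac{2}{3} h_3 e_{1,5} e_{2,4} e_{4,6} - \frac{2}{3} h_3 e_{1,6} e_{2,3} e_{3,5} \\ & + \frac{2}{3} h_3 e_{1,6} e_{2,4} e_{4,5} - \frac{2}{15} h_3 h_3 e_{1,5} e_{2,6} \\ & + \frac{2}{15} h_3 h_3 e_{1,6} e_{2,5} + \frac{4}{15} h_3 h_4 e_{1,5} e_{2,6} \\ & - \frac{4}{15} h_3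 h_4 e_{1,6} e_{2,5} + \frac{2}{15} h_3 h_5 e_{1,5} e_{2,6} \\ & - \frac{2}{15} h_3 h_5 e_{1,6} e_{2,5} + \frac{2}{3} h_4 e_{1,3} e_{2,5} e_{3,6} \\ & - \frac{2}{3} h_4 e_{1,3} e_{2,6} e_{3,5} + \frac{2}{3} h_4 e_{1,4} e_{2,5} e_{4,6} \\ & - \frac{2}{3} h_4 e_{1,4} e_{2,6} e_{4,5} - \frac{2}{3} h_4 e_{1,5} e_{2,3} e_{3,6} \\ & - \frac{2}{3} h_4 e_{1,5} e_{2,4} e_{4,6} + \frac{2}{3} h_4 e_{1,6} e_{2,3} e_{3,5} \\ & + \frac{2}{3} h_4 e_{1,6} e_{2,4} e_{4,5} + \frac{2}{5} h_4 h_4 e_{1,5} e_{2,6} \\ & - \frac{2}{5} h_4 h_4 e_{1,6} e_{2,5} + \frac{2}{5} h_4 h_5 e_{1,5} e_{2,6} \\ & - \frac{2}{5} h_4 h_5 e_{1,6} e_{2,5} - \frac{2}{3} h_5 e_{1,2} e_{2,5} e_{2,6} \\ & - \frac{2}{3} h_5 e_{1,3} e_{2,6} e_{3,5} - \frac{2}{3}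 h_5 e_{1,4} e_{2,6} e_{4,5} \\ & + \frac{2}{3} h_5 e_{1,6} e_{2,3} e_{3,5} + \frac{2}{3} h_5 e_{1,6} e_{2,4} e_{4,5} \\ & + \frac{2}{3} h_5 f_{1,2} e_{1,5} e_{1,6}. \end{aligned}$$ Let $R\subset\mathcal U(\mathfrak g)$ be the $\mathcal U(\mathfrak g)$-submodule generated by $v'$ under the adjoint action $X_L u=Xu-uX$ ($X\in\mathfrak g$, $u\in\mathcal U(\mathfrak g)$), and let $R_0=\{r\in R : Hr-rH=0 \text{ for all } H\in\mathfrak h\}$ be its zero-weight space. For $\mu\in\mathfrak h^*$ let $V(\mu)$ be the irreducible highest weight $\mathfrak g$-module with highest weight $\mu$ and highest weight vector $v_\mu$. For $r\in R_0$ let $p_r\in\mathcal S(\mathfrak h)=\mathbb C[h_1,\dots,h_5]$ be the polynomial with $r v_\mu=p_r(\mu)v_\mu$ for all $\mu\in\mathfrak h^*$, where $p_r(\mu)$ is obtained by substituting $\mu(h_i)$ for $h_i$, and set $\mathcal P_0=\{p_r : r\in R_0\}$. Then $$\mathcal P_0=\operatorname{span}_{\mathbb C}\{p_1,\dots,p_9\},$$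 where $$\begin{aligned} p_1={}&h_1 h_3 (65 + 10 h_1 + 12 h_2 - 8 h_1 h_2 - 8 h_2^2 + 66 h_3 + 4 h_1 h_3 + 8 h_2 h_3 \\ &\quad + 16 h_3^2 + 112 h_4 + 16 h_1 h_4 + 32 h_2 h_4 + 48 h_3 h_4 + 32 h_4^2 + 40 h_5 \\ &\quad + 8 h_1 h_5 + 16 h_2 h_5 + 24 h_3 h_5 + 32 h_4 h_5),\\ p_2={}&h_1 h_4 (45 + 10 h_1 + 28 h_2 + 8 h_1 h_2 + 8 h_2^2 + 84 h_3 + 16 h_1 h_3 \\ &\quad + 32 h_2 h_3 + 24 h_3^2 + 38 h_4 + 4 h_1 h_4 + 8 h_2 h_4 + 32 h_3 h_4 + 8 h_4^2 \\ &\quad - 8 h_1 h_5 - 16 h_2 h_5 + 16 h_3 h_5 + 8 h_4 h_5),\\ p_3={}&h_1 h_5 (75 + 30 h_1 + 68 h_2 + 8 h_1 h_2 + 8 h_2^2 + 84 h_3 + 16 h_1 h_3 \\ &\quad + 32 h_2 h_3 + 24 h_3^2 + 68 h_4 + 24 h_1 h_4 + 48 h_2 h_4 + 32 h_3 h_4 +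 8 h_4^2 \\ &\quad + 30 h_5 + 12 h_1 h_5 + 24 h_2 h_5 + 16 h_3 h_5 + 8 h_4 h_5),\\ p_4={}&h_2 h_4 (75 + 40 h_1 + 58 h_2 + 8 h_1 h_2 + 8 h_2^2 + 84 h_3 + 16 h_1 h_3 \\ &\quad + 32 h_2 h_3 + 24 h_3^2 + 58 h_4 + 24 h_1 h_4 + 28 h_2 h_4 + 32 h_3 h_4 + 8 h_4^2 \\ &\quad + 40 h_5 + 32 h_1 h_5 + 24 h_2 h_5 + 16 h_3 h_5 + 8 h_4 h_5),\\ p_5={}&h_2 h_5 (45 + 38 h_2 + 8 h_1 h_2 + 8 h_2^2 + 84 h_3 + 16 h_1 h_3 + 32 h_2 h_3 \\ &\quad + 24 h_3^2 + 28 h_4 - 16 h_1 h_4 + 8 h_2 h_4 + 32 h_3 h_4 + 8 h_4^2 + 10 h_5 \\ &\quad - 8 h_1 h_5 + 4 h_2 h_5 + 16 h_3 h_5 + 8 h_4 h_5),\\ p_6={}&h_3 h_5 (65 + 40 h_1 + 112 h_2 + 32 h_1 h_2 + 32 h_2^2 + 66 h_3 + 24 h_1 h_3 \\ &\quad + 48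 h_2 h_3 + 16 h_3^2 + 12 h_4 + 16 h_1 h_4 + 32 h_2 h_4 + 8 h_3 h_4 - 8 h_4^2 \\ &\quad + 10 h_5 + 8 h_1 h_5 + 16 h_2 h_5 + 4 h_3 h_5 - 8 h_4 h_5),\\ p_7={}&h_2 (\tfrac72 + h_1 + h_2 + h_3 + h_4 + h_5) (15 + 15 h_1 + 21 h_2 + 6 h_1 h_2 \\ &\quad + 6 h_2^2 + 23 h_3 + 12 h_1 h_3 + 14 h_2 h_3 + 8 h_3^2 + h_4 + 8 h_1 h_4 + 6 h_2 h_4 \\ &\quad + 4 h_3 h_4 - 4 h_4^2 - 5 h_5 + 4 h_1 h_5 - 2 h_2 h_5 - 8 h_3 h_5 - 4 h_4 h_5),\\ p_8={}&h_3(\tfrac72 + h_1 + h_2 + h_3 + h_4 + h_5)(5 - 5 h_1 + 9 h_2 + 4 h_1 h_2 + 4 h_2^2 \\ &\quad + 7 h_3 - 2 h_1 h_3 + 6 h_2 h_3 + 2 h_3^2 + 9 h_4 - 8 h_1 h_4 + 4 h_2 h_4 \\ &\quad + 6 h_3 h_4 + 4 h_4^2 - 5 h_5 - 4 h_1 h_5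 - 8 h_2 h_5 - 2 h_3 h_5 + 4 h_4 h_5),\\ p_9={}&h_4 (\tfrac72 + h_1 + h_2 + h_3 + h_4 + h_5)(15 - 5 h_1 + h_2 - 4 h_1 h_2 - 4 h_2^2 \\ &\quad + 23 h_3 - 8 h_1 h_3 + 4 h_2 h_3 + 8 h_3^2 + 21 h_4 - 2 h_1 h_4 + 6 h_2 h_4 \\ &\quad + 14 h_3 h_4 + 6 h_4^2 + 15 h_5 + 4 h_1 h_5 + 8 h_2 h_5 + 12 h_3 h_5 + 6 h_4 h_5). \end{aligned}$$ Moreover, $p_1,\dots,p_9$ are linearly independent, so that $\dim_{\mathbb C}\mathcal P_0=9$. -/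

import Mathlib

noncomputable section

namespace SL6

open MvPolynomial

attribute [local instance 100] LieRing.ofAssociativeRing

/-- The Lie algebra `𝔰𝔩₆` of traceless complex `6 × 6` matrices. -/
abbrev g : LieSubalgebra ℂ (Matrix (Fin 6) (Fin 6) ℂ) :=
  LieAlgebra.SpecialLinear.sl (Fin 6) ℂ

/-- The universal enveloping algebra of `𝔰𝔩₆`. -/
abbrev U : Type := UniversalEnvelopingAlgebra ℂ g

/-- The inclusion of `𝔰𝔩₆` in its universal enveloping algebra. -/
def inc (A : g) : U := UniversalEnvelopingAlgebra.ι ℂ A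

/-- The Cartan subalgebra of traceless diagonal matrices (as a vector space). -/
def cartan : Submodule ℂ g where
  carrier := {A | (A : Matrix (Fin 6) (Fin 6) ℂ).IsDiag}
  add_mem' {A B} hA hB := by
    intro i j hij
    simp [hA hij, hB hij]
  zero_mem' := by
    intro i j _
    simp
  smul_mem' c A hA := by
    intro i j hij
    simp [hA hij]

/-- Membership in `𝔫₊`, the strictly upper triangular matrices. -/
def IsStrictlyUpper (A : g) : Prop :=
  ∀ i j : Fin 6, j ≤ i → (A : Matrix (Fin 6) (Fin 6) ℂ) i j = 0

/-- Rows and columns are numbered `1, …, 6` in formulas: `ix k` is the `k`-th index. -/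
def ix (k : ℕ) : Fin 6 := Fin.ofNat 6 (k - 1)

/-- The root vector `e_{i,j}`, that is, the matrix unit `E_{i,j}`, in the enveloping algebra
(used for `1 ≤ i < j ≤ 6`). -/
def e (i j : ℕ) (hij : ix i ≠ ix j := by decide) : U :=
  inc (LieAlgebra.SpecialLinear.single (ix i) (ix j) hij 1)

/-- The root vector `f_{i,j}`, that is, the matrix unit `E_{j,i}`, in the enveloping algebra
(used for `1 ≤ i < j ≤ 6`). -/
def f (i j : ℕ) (hji : ix j ≠ ix i := by decide) : U :=
  inc (LieAlgebra.SpecialLinear.single (ix j) (ix i) hji 1)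

/-- The simple coroot `h_i = E_{i,i} - E_{i+1,i+1}` in `𝔰𝔩₆`, for `i = 1, …, 5`. -/
def coroot (i : ℕ) : g :=
  LieAlgebra.SpecialLinear.singleSubSingle (ix i) (ix (i + 1)) 1

/-- The simple coroot `h_i` in the enveloping algebra, for `i = 1, …, 5`. -/
def h (i : ℕ) : U := inc (coroot i)

theorem coroot_mem_cartan (i : ℕ) : coroot i ∈ cartan := by
  intro a b hab
  simp only [coroot, LieAlgebra.SpecialLinear.val_singleSubSingle, Matrix.sub_apply]
  rw [Matrix.single_apply_of_ne, Matrix.single_apply_of_ne, sub_zero]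
  · rintro ⟨rfl, rfl⟩
    exact hab rfl
  · rintro ⟨rfl, rfl⟩
    exact hab rfl

/-- The vector `v'` of the enveloping algebra. -/
def v' : U :=
    (7 / 2 : ℂ) • (e 1 5 * e 2 6) - (7 / 2 : ℂ) • (e 1 6 * e 2 5)
    - (4 / 3 : ℂ) • (e 1 2 * e 2 5 * e 2 6) + (1 / 3 : ℂ) • (e 1 3 * e 2 5 * e 3 6)
    - (5 / 3 : ℂ) • (e 1 3 * e 2 6 * e 3 5) + (5 / 3 : ℂ) • (e 1 4 * e 2 5 * e 4 6)
    - (3 : ℂ) • (e 1 4 * e 2 6 * e 4 5) - (1 / 3 : ℂ) • (e 1 5 * e 2 3 * e 3 6)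
    - (5 / 3 : ℂ) • (e 1 5 * e 2 4 * e 4 6) + (5 / 3 : ℂ) • (e 1 6 * e 2 3 * e 3 5)
    + (3 : ℂ) • (e 1 6 * e 2 4 * e 4 5) + (4 / 3 : ℂ) • (f 1 2 * e 1 5 * e 1 6)
    - h 1 * e 1 5 * e 2 6 - (1 / 3 : ℂ) • (h 1 * e 1 6 * e 2 5)
    - (4 / 15 : ℂ) • (h 2 * e 1 5 * e 2 6) + (4 / 15 : ℂ) • (h 2 * e 1 6 * e 2 5)
    + (8 / 15 : ℂ) • (h 3 * e 1 5 * e 2 6) - (8 / 15 : ℂ) • (h 3 * e 1 6 * e 2 5)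
    + (12 / 5 : ℂ) • (h 4 * e 1 5 * e 2 6) - (12 / 5 : ℂ) • (h 4 * e 1 6 * e 2 5)
    + h 5 * e 1 5 * e 2 6 - h 5 * e 1 6 * e 2 5 + (2 / 3 : ℂ) • (e 1 2 * e 2 3 * e 2 5 * e 3 6)
    - (2 / 3 : ℂ) • (e 1 2 * e 2 3 * e 2 6 * e 3 5)
    + (2 / 3 : ℂ) • (e 1 2 * e 2 4 * e 2 5 * e 4 6)
    - (2 / 3 : ℂ) • (e 1 2 * e 2 4 * e 2 6 * e 4 5)
    + (2 / 3 : ℂ) • (e 1 2 * e 2 5 * e 2 5 * e 5 6) + (2 : ℂ) • (e 1 3 * e 2 4 * e 3 5 * e 4 6)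
    - (2 : ℂ) • (e 1 3 * e 2 4 * e 3 6 * e 4 5) - (4 / 3 : ℂ) • (e 1 3 * e 2 5 * e 3 4 * e 4 6)
    + (2 / 3 : ℂ) • (e 1 3 * e 2 5 * e 3 5 * e 5 6)
    + (4 / 3 : ℂ) • (e 1 3 * e 2 6 * e 3 4 * e 4 5) - (2 : ℂ) • (e 1 4 * e 2 3 * e 3 5 * e 4 6)
    + (2 : ℂ) • (e 1 4 * e 2 3 * e 3 6 * e 4 5) + (2 / 3 : ℂ) • (e 1 4 * e 2 5 * e 4 5 * e 5 6)
    + (4 / 3 : ℂ) • (e 1 5 * e 2 3 * e 3 4 * e 4 6)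
    - (2 / 3 : ℂ) • (e 1 5 * e 2 3 * e 3 5 * e 5 6)
    - (2 / 3 : ℂ) • (e 1 5 * e 2 4 * e 4 5 * e 5 6)
    - (4 / 3 : ℂ) • (e 1 6 * e 2 3 * e 3 4 * e 4 5)
    - (2 / 5 : ℂ) • (f 1 2 * e 1 2 * e 1 5 * e 2 6)
    + (2 / 5 : ℂ) • (f 1 2 * e 1 2 * e 1 6 * e 2 5)
    - (2 / 3 : ℂ) • (f 1 2 * e 1 3 * e 1 5 * e 3 6)
    + (2 / 3 : ℂ) • (f 1 2 * e 1 3 * e 1 6 * e 3 5)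
    - (2 / 3 : ℂ) • (f 1 2 * e 1 4 * e 1 5 * e 4 6)
    + (2 / 3 : ℂ) • (f 1 2 * e 1 4 * e 1 6 * e 4 5)
    - (2 / 3 : ℂ) • (f 1 2 * e 1 5 * e 1 5 * e 5 6)
    + (4 / 15 : ℂ) • (f 1 3 * e 1 3 * e 1 5 * e 2 6)
    - (4 / 15 : ℂ) • (f 1 3 * e 1 3 * e 1 6 * e 2 5)
    + (4 / 15 : ℂ) • (f 1 4 * e 1 4 * e 1 5 * e 2 6)
    - (4 / 15 : ℂ) • (f 1 4 * e 1 4 * e 1 6 * e 2 5)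
    + (4 / 15 : ℂ) • (f 1 5 * e 1 5 * e 1 5 * e 2 6)
    - (4 / 15 : ℂ) • (f 1 5 * e 1 5 * e 1 6 * e 2 5)
    + (4 / 15 : ℂ) • (f 1 6 * e 1 5 * e 1 6 * e 2 6)
    - (4 / 15 : ℂ) • (f 1 6 * e 1 6 * e 1 6 * e 2 5)
    + (4 / 15 : ℂ) • (f 2 3 * e 1 5 * e 2 3 * e 2 6)
    - (4 / 15 : ℂ) • (f 2 3 * e 1 6 * e 2 3 * e 2 5)
    + (4 / 15 : ℂ) • (f 2 4 * e 1 5 * e 2 4 * e 2 6)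
    - (4 / 15 : ℂ) • (f 2 4 * e 1 6 * e 2 4 * e 2 5)
    + (4 / 15 : ℂ) • (f 2 5 * e 1 5 * e 2 5 * e 2 6)
    - (4 / 15 : ℂ) • (f 2 5 * e 1 6 * e 2 5 * e 2 5)
    + (4 / 15 : ℂ) • (f 2 6 * e 1 5 * e 2 6 * e 2 6)
    - (4 / 15 : ℂ) • (f 2 6 * e 1 6 * e 2 5 * e 2 6)
    - (4 / 3 : ℂ) • (f 3 4 * e 1 4 * e 2 5 * e 3 6)
    + (4 / 3 : ℂ) • (f 3 4 * e 1 4 * e 2 6 * e 3 5)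
    + (4 / 3 : ℂ) • (f 3 4 * e 1 5 * e 2 4 * e 3 6)
    - (16 / 15 : ℂ) • (f 3 4 * e 1 5 * e 2 6 * e 3 4)
    - (4 / 3 : ℂ) • (f 3 4 * e 1 6 * e 2 4 * e 3 5)
    + (16 / 15 : ℂ) • (f 3 4 * e 1 6 * e 2 5 * e 3 4)
    + (4 / 15 : ℂ) • (f 3 5 * e 1 5 * e 2 6 * e 3 5)
    - (4 / 15 : ℂ) • (f 3 5 * e 1 6 * e 2 5 * e 3 5)
    + (4 / 15 : ℂ) • (f 3 6 * e 1 5 * e 2 6 * e 3 6)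
    - (4 / 15 : ℂ) • (f 3 6 * e 1 6 * e 2 5 * e 3 6)
    + (4 / 15 : ℂ) • (f 4 5 * e 1 5 * e 2 6 * e 4 5)
    - (4 / 15 : ℂ) • (f 4 5 * e 1 6 * e 2 5 * e 4 5)
    + (4 / 15 : ℂ) • (f 4 6 * e 1 5 * e 2 6 * e 4 6)
    - (4 / 15 : ℂ) • (f 4 6 * e 1 6 * e 2 5 * e 4 6)
    - (2 / 3 : ℂ) • (f 5 6 * e 1 2 * e 2 6 * e 2 6)
    - (2 / 3 : ℂ) • (f 5 6 * e 1 3 * e 2 6 * e 3 6)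
    - (2 / 3 : ℂ) • (f 5 6 * e 1 4 * e 2 6 * e 4 6)
    - (2 / 5 : ℂ) • (f 5 6 * e 1 5 * e 2 6 * e 5 6)
    + (2 / 3 : ℂ) • (f 5 6 * e 1 6 * e 2 3 * e 3 6)
    + (2 / 3 : ℂ) • (f 5 6 * e 1 6 * e 2 4 * e 4 6)
    + (2 / 5 : ℂ) • (f 5 6 * e 1 6 * e 2 5 * e 5 6)
    + (2 / 3 : ℂ) • (f 5 6 * f 1 2 * e 1 6 * e 1 6) + (2 / 3 : ℂ) • (h 1 * e 1 5 * e 2 3 * e 3 6)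
    + (2 / 3 : ℂ) • (h 1 * e 1 5 * e 2 4 * e 4 6) + (2 / 3 : ℂ) • (h 1 * e 1 5 * e 2 5 * e 5 6)
    - (2 / 3 : ℂ) • (h 1 * e 1 6 * e 2 3 * e 3 5) - (2 / 3 : ℂ) • (h 1 * e 1 6 * e 2 4 * e 4 5)
    - (2 / 3 : ℂ) • (h 1 * f 5 6 * e 1 6 * e 2 6) + (2 / 5 : ℂ) • (h 1 * h 2 * e 1 5 * e 2 6)
    - (2 / 5 : ℂ) • (h 1 * h 2 * e 1 6 * e 2 5) + (2 / 15 : ℂ) • (h 1 * h 3 * e 1 5 * e 2 6)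
    - (2 / 15 : ℂ) • (h 1 * h 3 * e 1 6 * e 2 5) - (2 / 15 : ℂ) • (h 1 * h 4 * e 1 5 * e 2 6)
    + (2 / 15 : ℂ) • (h 1 * h 4 * e 1 6 * e 2 5) - (2 / 5 : ℂ) • (h 1 * h 5 * e 1 5 * e 2 6)
    - (4 / 15 : ℂ) • (h 1 * h 5 * e 1 6 * e 2 5) - (2 / 3 : ℂ) • (h 2 * e 1 3 * e 2 5 * e 3 6)
    + (2 / 3 : ℂ) • (h 2 * e 1 3 * e 2 6 * e 3 5) - (2 / 3 : ℂ) • (h 2 * e 1 4 * e 2 5 * e 4 6)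
    + (2 / 3 : ℂ) • (h 2 * e 1 4 * e 2 6 * e 4 5) + (2 / 3 : ℂ) • (h 2 * e 1 5 * e 2 3 * e 3 6)
    + (2 / 3 : ℂ) • (h 2 * e 1 5 * e 2 4 * e 4 6) - (2 / 3 : ℂ) • (h 2 * e 1 6 * e 2 3 * e 3 5)
    - (2 / 3 : ℂ) • (h 2 * e 1 6 * e 2 4 * e 4 5) + (2 / 5 : ℂ) • (h 2 * h 2 * e 1 5 * e 2 6)
    - (2 / 5 : ℂ) • (h 2 * h 2 * e 1 6 * e 2 5) + (4 / 15 : ℂ) • (h 2 * h 3 * e 1 5 * e 2 6)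
    - (4 / 15 : ℂ) • (h 2 * h 3 * e 1 6 * e 2 5) - (4 / 15 : ℂ) • (h 2 * h 4 * e 1 5 * e 2 6)
    + (4 / 15 : ℂ) • (h 2 * h 4 * e 1 6 * e 2 5) - (2 / 15 : ℂ) • (h 2 * h 5 * e 1 5 * e 2 6)
    + (2 / 15 : ℂ) • (h 2 * h 5 * e 1 6 * e 2 5) - (2 / 3 : ℂ) • (h 3 * e 1 3 * e 2 5 * e 3 6)
    + (2 / 3 : ℂ) • (h 3 * e 1 3 * e 2 6 * e 3 5) + (2 / 3 : ℂ) • (h 3 * e 1 4 * e 2 5 * e 4 6)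
    - (2 / 3 : ℂ) • (h 3 * e 1 4 * e 2 6 * e 4 5) + (2 / 3 : ℂ) • (h 3 * e 1 5 * e 2 3 * e 3 6)
    - (2 / 3 : ℂ) • (h 3 * e 1 5 * e 2 4 * e 4 6) - (2 / 3 : ℂ) • (h 3 * e 1 6 * e 2 3 * e 3 5)
    + (2 / 3 : ℂ) • (h 3 * e 1 6 * e 2 4 * e 4 5) - (2 / 15 : ℂ) • (h 3 * h 3 * e 1 5 * e 2 6)
    + (2 / 15 : ℂ) • (h 3 * h 3 * e 1 6 * e 2 5) + (4 / 15 : ℂ) • (h 3 * h 4 * e 1 5 * e 2 6)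
    - (4 / 15 : ℂ) • (h 3 * h 4 * e 1 6 * e 2 5) + (2 / 15 : ℂ) • (h 3 * h 5 * e 1 5 * e 2 6)
    - (2 / 15 : ℂ) • (h 3 * h 5 * e 1 6 * e 2 5) + (2 / 3 : ℂ) • (h 4 * e 1 3 * e 2 5 * e 3 6)
    - (2 / 3 : ℂ) • (h 4 * e 1 3 * e 2 6 * e 3 5) + (2 / 3 : ℂ) • (h 4 * e 1 4 * e 2 5 * e 4 6)
    - (2 / 3 : ℂ) • (h 4 * e 1 4 * e 2 6 * e 4 5) - (2 / 3 : ℂ) • (h 4 * e 1 5 * e 2 3 * e 3 6)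
    - (2 / 3 : ℂ) • (h 4 * e 1 5 * e 2 4 * e 4 6) + (2 / 3 : ℂ) • (h 4 * e 1 6 * e 2 3 * e 3 5)
    + (2 / 3 : ℂ) • (h 4 * e 1 6 * e 2 4 * e 4 5) + (2 / 5 : ℂ) • (h 4 * h 4 * e 1 5 * e 2 6)
    - (2 / 5 : ℂ) • (h 4 * h 4 * e 1 6 * e 2 5) + (2 / 5 : ℂ) • (h 4 * h 5 * e 1 5 * e 2 6)
    - (2 / 5 : ℂ) • (h 4 * h 5 * e 1 6 * e 2 5) - (2 / 3 : ℂ) • (h 5 * e 1 2 * e 2 5 * e 2 6)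
    - (2 / 3 : ℂ) • (h 5 * e 1 3 * e 2 6 * e 3 5) - (2 / 3 : ℂ) • (h 5 * e 1 4 * e 2 6 * e 4 5)
    + (2 / 3 : ℂ) • (h 5 * e 1 6 * e 2 3 * e 3 5) + (2 / 3 : ℂ) • (h 5 * e 1 6 * e 2 4 * e 4 5)
    + (2 / 3 : ℂ) • (h 5 * f 1 2 * e 1 5 * e 1 6)

/-- The submodule `R` of the enveloping algebra generated by `v'` under the adjoint action
`X_L u = X u - u X`: the least subspace that contains `v'` and is stable under all `X_L`. -/
def R : Submodule ℂ U :=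
  sInf {N : Submodule ℂ U | v' ∈ N ∧ ∀ A : g, ∀ u ∈ N, inc A * u - u * inc A ∈ N}

/-- The zero-weight space `R₀` of `R`. -/
def R0 : Submodule ℂ U where
  carrier := {r | r ∈ R ∧ ∀ H ∈ cartan, inc H * r - r * inc H = 0}
  add_mem' {a b} ha hb := by
    refine ⟨R.add_mem ha.1 hb.1, fun H hH => ?_⟩
    rw [mul_add, add_mul, add_sub_add_comm, ha.2 H hH, hb.2 H hH, add_zero]
  zero_mem' := ⟨R.zero_mem, fun H _ => by simp⟩
  smul_mem' c a ha := by
    refine ⟨R.smul_mem c ha.1, fun H hH => ?_⟩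
    rw [mul_smul_comm, smul_mul_assoc, ← smul_sub, ha.2 H hH, smul_zero]

/-- `M` is an irreducible highest weight module of highest weight `μ ∈ 𝔥*`, with highest weight
vector `v`; that `v` generates `M` follows from irreducibility. -/
structure IsIrreducibleHighestWeight (μ : Module.Dual ℂ cartan) (M : Type)
    [AddCommGroup M] [Module U M] (v : M) : Prop where
  irreducible : IsSimpleModule U M
  ne_zero : v ≠ 0
  raising : ∀ A : g, IsStrictlyUpper A → inc A • v = 0
  weight : ∀ H : cartan, inc (H : g) • v = algebraMap ℂ U (μ H) • v

/-- The value at `μ ∈ 𝔥*` of a polynomial in the simple coroots `h_1, …, h_5`, which form a basis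
of `𝔥`, so that `S(𝔥) = ℂ[h_1, …, h_5]`; the variable `X i` with `i : Fin 5` is `h_{i+1}`. -/
def evalAt (μ : Module.Dual ℂ cartan) (p : MvPolynomial (Fin 5) ℂ) : ℂ :=
  MvPolynomial.eval (fun i : Fin 5 => μ ⟨coroot (i.val + 1), coroot_mem_cartan (i.val + 1)⟩) p

/-- `p` is the polynomial `p_r`: `r v_μ = p(μ) v_μ` for every `μ ∈ 𝔥*`, where `v_μ` is the highest
weight vector of the irreducible module of highest weight `μ`. Such a module exists for every `μ` and is
unique up to isomorphism; being cyclic, it is a quotient of `U`, so `Type` is large enough. -/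
def IsPolyOf (r : U) (p : MvPolynomial (Fin 5) ℂ) : Prop :=
  ∀ (μ : Module.Dual ℂ cartan) (M : Type) [AddCommGroup M] [Module U M] (v : M),
    IsIrreducibleHighestWeight μ M v → r • v = algebraMap ℂ U (evalAt μ p) • v

/-- The space `𝒫₀` of the polynomials `p_r` with `r ∈ R₀`. -/
def P0 : Submodule ℂ (MvPolynomial (Fin 5) ℂ) where
  carrier := {p | ∃ r ∈ R0, IsPolyOf r p}
  add_mem' {p q} := by
    rintro ⟨r, hr, hrp⟩ ⟨s, hs, hsq⟩
    refine ⟨r + s, R0.add_mem hr hs, fun μ M _ _ v hv => ?_⟩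
    rw [add_smul, hrp μ M v hv, hsq μ M v hv, evalAt, evalAt, evalAt, map_add, map_add, add_smul]
  zero_mem' := ⟨0, R0.zero_mem, fun μ M _ _ v _ => by simp [evalAt]⟩
  smul_mem' c p := by
    rintro ⟨r, hr, hrp⟩
    refine ⟨c • r, R0.smul_mem c hr, fun μ M _ _ v hv => ?_⟩
    rw [Algebra.smul_def, mul_smul, hrp μ M v hv, evalAt, evalAt, MvPolynomial.smul_eval, map_mul,
      mul_smul]

/-- The polynomial variables `h1, …, h5`, numbered as the simple coroots `h_1, …, h_5`. -/
abbrev h1 : MvPolynomial (Fin 5) ℂ := X 0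
abbrev h2 : MvPolynomial (Fin 5) ℂ := X 1
abbrev h3 : MvPolynomial (Fin 5) ℂ := X 2
abbrev h4 : MvPolynomial (Fin 5) ℂ := X 3
abbrev h5 : MvPolynomial (Fin 5) ℂ := X 4

/-- The polynomial `p_1`. -/
def p1 : MvPolynomial (Fin 5) ℂ :=
    h1 * h3 * (65 + 10 * h1 + 12 * h2 - 8 * h1 * h2 - 8 * h2 ^ 2 + 66 * h3 + 4 * h1 * h3
      + 8 * h2 * h3 + 16 * h3 ^ 2 + 112 * h4 + 16 * h1 * h4 + 32 * h2 * h4 + 48 * h3 * h4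
      + 32 * h4 ^ 2 + 40 * h5 + 8 * h1 * h5 + 16 * h2 * h5 + 24 * h3 * h5 + 32 * h4 * h5)

/-- The polynomial `p_2`. -/
def p2 : MvPolynomial (Fin 5) ℂ :=
    h1 * h4 * (45 + 10 * h1 + 28 * h2 + 8 * h1 * h2 + 8 * h2 ^ 2 + 84 * h3 + 16 * h1 * h3
      + 32 * h2 * h3 + 24 * h3 ^ 2 + 38 * h4 + 4 * h1 * h4 + 8 * h2 * h4 + 32 * h3 * h4
      + 8 * h4 ^ 2 - 8 * h1 * h5 - 16 * h2 * h5 + 16 * h3 * h5 + 8 * h4 * h5)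

/-- The polynomial `p_3`. -/
def p3 : MvPolynomial (Fin 5) ℂ :=
    h1 * h5 * (75 + 30 * h1 + 68 * h2 + 8 * h1 * h2 + 8 * h2 ^ 2 + 84 * h3 + 16 * h1 * h3
      + 32 * h2 * h3 + 24 * h3 ^ 2 + 68 * h4 + 24 * h1 * h4 + 48 * h2 * h4 + 32 * h3 * h4
      + 8 * h4 ^ 2 + 30 * h5 + 12 * h1 * h5 + 24 * h2 * h5 + 16 * h3 * h5 + 8 * h4 * h5)

/-- The polynomial `p_4`. -/
def p4 : MvPolynomial (Fin 5) ℂ :=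
    h2 * h4 * (75 + 40 * h1 + 58 * h2 + 8 * h1 * h2 + 8 * h2 ^ 2 + 84 * h3 + 16 * h1 * h3
      + 32 * h2 * h3 + 24 * h3 ^ 2 + 58 * h4 + 24 * h1 * h4 + 28 * h2 * h4 + 32 * h3 * h4
      + 8 * h4 ^ 2 + 40 * h5 + 32 * h1 * h5 + 24 * h2 * h5 + 16 * h3 * h5 + 8 * h4 * h5)

/-- The polynomial `p_5`. -/
def p5 : MvPolynomial (Fin 5) ℂ :=
    h2 * h5 * (45 + 38 * h2 + 8 * h1 * h2 + 8 * h2 ^ 2 + 84 * h3 + 16 * h1 * h3 + 32 * h2 * h3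
      + 24 * h3 ^ 2 + 28 * h4 - 16 * h1 * h4 + 8 * h2 * h4 + 32 * h3 * h4 + 8 * h4 ^ 2 + 10 * h5
      - 8 * h1 * h5 + 4 * h2 * h5 + 16 * h3 * h5 + 8 * h4 * h5)

/-- The polynomial `p_6`. -/
def p6 : MvPolynomial (Fin 5) ℂ :=
    h3 * h5 * (65 + 40 * h1 + 112 * h2 + 32 * h1 * h2 + 32 * h2 ^ 2 + 66 * h3 + 24 * h1 * h3
      + 48 * h2 * h3 + 16 * h3 ^ 2 + 12 * h4 + 16 * h1 * h4 + 32 * h2 * h4 + 8 * h3 * h4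
      - 8 * h4 ^ 2 + 10 * h5 + 8 * h1 * h5 + 16 * h2 * h5 + 4 * h3 * h5 - 8 * h4 * h5)

/-- The polynomial `p_7`. -/
def p7 : MvPolynomial (Fin 5) ℂ :=
    h2 * (C (7 / 2) + h1 + h2 + h3 + h4 + h5) * (15 + 15 * h1 + 21 * h2 + 6 * h1 * h2
      + 6 * h2 ^ 2 + 23 * h3 + 12 * h1 * h3 + 14 * h2 * h3 + 8 * h3 ^ 2 + h4 + 8 * h1 * h4
      + 6 * h2 * h4 + 4 * h3 * h4 - 4 * h4 ^ 2 - 5 * h5 + 4 * h1 * h5 - 2 * h2 * h5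
      - 8 * h3 * h5 - 4 * h4 * h5)

/-- The polynomial `p_8`. -/
def p8 : MvPolynomial (Fin 5) ℂ :=
    h3 * (C (7 / 2) + h1 + h2 + h3 + h4 + h5) * (5 - 5 * h1 + 9 * h2 + 4 * h1 * h2 + 4 * h2 ^ 2
      + 7 * h3 - 2 * h1 * h3 + 6 * h2 * h3 + 2 * h3 ^ 2 + 9 * h4 - 8 * h1 * h4 + 4 * h2 * h4
      + 6 * h3 * h4 + 4 * h4 ^ 2 - 5 * h5 - 4 * h1 * h5 - 8 * h2 * h5 - 2 * h3 * h5
      + 4 * h4 * h5)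

/-- The polynomial `p_9`. -/
def p9 : MvPolynomial (Fin 5) ℂ :=
    h4 * (C (7 / 2) + h1 + h2 + h3 + h4 + h5) * (15 - 5 * h1 + h2 - 4 * h1 * h2 - 4 * h2 ^ 2
      + 23 * h3 - 8 * h1 * h3 + 4 * h2 * h3 + 8 * h3 ^ 2 + 21 * h4 - 2 * h1 * h4 + 6 * h2 * h4
      + 14 * h3 * h4 + 6 * h4 ^ 2 + 15 * h5 + 4 * h1 * h5 + 8 * h2 * h5 + 12 * h3 * h5
      + 6 * h4 * h5)

/-- The family `p_1, …, p_9`. -/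
def p : Fin 9 → MvPolynomial (Fin 5) ℂ := ![p1, p2, p3, p4, p5, p6, p7, p8, p9]

end SL6

end

noncomputable section

namespace SL6

open MvPolynomial

attribute [local instance 100] LieRing.ofAssociativeRing

/-! ### Matrix units in the enveloping algebra -/

/-! Let `E` be the matrix of the traceless parts of the matrix units, with entries in `U`. Its
powers transform under the adjoint action as matrix units do, so the 2 × 2 minors formed from two
powers transform as the tensors of `V ∧ V ⊗ V* ∧ V*`, where `V = ℂ⁶`. One combination `T` of such
minors, partly multiplied by the Casimir element, has `v'` as the entry `T 0 1 4 5` (`v'_eq_T`).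
This turns the adjoint module of a long explicit element into tensor algebra.

Upper bound for `R₀`: the coefficient tensor of `v'` has no contractions, and the action preserves
this property, so `R` consists of combinations of `T` with traceless coefficients. In weight zero
only the `T a b a b` remain. Their coefficients form a symmetric 6 × 6 matrix with zero diagonal and
zero row sums, that is, an edge weighting of the complete graph on six vertices with sum zero at
each vertex (`exists_of_mem_R0`). These weightings have dimension 15 - 6 = 9.

Lower bound: two matrix units applied to an entry `T a b c d` in `R` give the alternating weighting
of the 4-cycle `a b c d` (`cycle_mem_R0`). Nine such cycles span all the weightings
(`sum_diagT_eq`).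

On a highest weight vector the matrix `E` and its powers act as lower triangular matrices with
scalar diagonals given by a recursion (`IsHighest.acts_P`). This yields the scalar of `T a b a b`,
and the nine cycles give multiples of `p_1, …, p_9` (`eval_p`).

That `p_r` is determined by `r` requires enough highest weight modules. Dominant integral weights
suffice, because they are Zariski dense; their modules come from products of leading principal
minors. Linear independence follows by evaluation at a few points. -/

/-- The projection of a `6 × 6` matrix to its traceless part. -/
def traceless : Matrix (Fin 6) (Fin 6) ℂ →ₗ[ℂ] g :=
  LinearMap.codRestrict g.toSubmodule
    (LinearMap.id - (Matrix.traceLinearMap (Fin 6) ℂ ℂ).smulRight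
      ((1 / 6 : ℂ) • (1 : Matrix (Fin 6) (Fin 6) ℂ))) fun A => by
    change Matrix.trace (A - Matrix.trace A • (1 / 6 : ℂ) • (1 : Matrix (Fin 6) (Fin 6) ℂ)) = 0
    simp

theorem coe_traceless (A : Matrix (Fin 6) (Fin 6) ℂ) :
    (traceless A : Matrix (Fin 6) (Fin 6) ℂ) =
      A - Matrix.trace A • (1 / 6 : ℂ) • (1 : Matrix (Fin 6) (Fin 6) ℂ) := rfl

theorem trace_coe (A : g) : Matrix.trace (A : Matrix (Fin 6) (Fin 6) ℂ) = 0 := A.2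

theorem traceless_coe (A : g) : traceless (A : Matrix (Fin 6) (Fin 6) ℂ) = A := by
  apply Subtype.ext
  rw [coe_traceless, trace_coe, zero_smul, sub_zero]

theorem traceless_one : traceless (1 : Matrix (Fin 6) (Fin 6) ℂ) = 0 := by
  apply Subtype.ext
  rw [coe_traceless, Matrix.trace_one, smul_smul]
  simp

/-- Scalar matrices are central and commutators have trace zero. Hence the traceless parts of the
matrix units satisfy the relations of `𝔤𝔩₆`, and all 36 symbols can be treated uniformly. -/
theorem traceless_lie (A B : Matrix (Fin 6) (Fin 6) ℂ) :
    traceless (A * B - B * A) = ⁅traceless A, traceless B⁆ := by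
  apply Subtype.ext
  rw [coe_traceless, LieAlgebra.SpecialLinear.sl_bracket, coe_traceless, coe_traceless,
    Matrix.trace_sub, Matrix.trace_mul_comm, sub_self, zero_smul, sub_zero]
  simp only [sub_mul, mul_sub, smul_mul_assoc, mul_smul_comm, one_mul, mul_one]
  module

/-- The inclusion of `𝔰𝔩₆` in `U` as a linear map. -/
def incₗ : g →ₗ[ℂ] U := (UniversalEnvelopingAlgebra.ι ℂ : g →ₗ⁅ℂ⁆ U)

theorem incₗ_apply (A : g) : incₗ A = inc A := rfl

theorem inc_lie (A B : g) : inc ⁅A, B⁆ = inc A * inc B - inc B * inc A := by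
  rw [inc, LieHom.map_lie, Ring.lie_def]
  rfl

/-- The traceless part of the matrix unit `E_{i,j}`, in the enveloping algebra. -/
def E (i j : Fin 6) : U := inc (traceless (Matrix.single i j 1))

/-- The Kronecker symbol. -/
def δ (i j : Fin 6) : ℂ := if i = j then 1 else 0

theorem δ_self (i : Fin 6) : δ i i = 1 := if_pos rfl

theorem δ_ne {i j : Fin 6} (hij : i ≠ j) : δ i j = 0 := if_neg hij

theorem sum_δ_smul {M : Type*} [AddCommGroup M] [Module ℂ M] (i : Fin 6) (x : Fin 6 → M) :
    ∑ k, δ i k • x k = x i := by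
  simp [δ, ite_smul]

theorem sum_δ_smul' {M : Type*} [AddCommGroup M] [Module ℂ M] (i : Fin 6) (x : Fin 6 → M) :
    ∑ k, δ k i • x k = x i := by
  simp [δ, ite_smul]

theorem sum_E_self : ∑ i, E i i = 0 := by
  simp only [E, ← incₗ_apply]
  rw [← map_sum, ← map_sum, Matrix.sum_single_one, traceless_one, map_zero]

theorem inc_eq_sum (A : g) :
    inc A = ∑ i, ∑ j, (A : Matrix (Fin 6) (Fin 6) ℂ) i j • E i j := by
  conv_lhs => rw [← traceless_coe A, Matrix.matrix_eq_sum_single (A : Matrix (Fin 6) (Fin 6) ℂ)]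
  simp only [← incₗ_apply, map_sum, E]
  refine Finset.sum_congr rfl fun i _ => Finset.sum_congr rfl fun j _ => ?_
  rw [← map_smul, ← map_smul, Matrix.smul_single, smul_eq_mul, mul_one]

/-- The inner derivation `u ↦ x u - u x` of `U`. -/
def ad (x : U) : U →ₗ[ℂ] U := LinearMap.mulLeft ℂ x - LinearMap.mulRight ℂ x

theorem ad_apply (x u : U) : ad x u = x * u - u * x := rfl

theorem ad_mul (x u w : U) : ad x (u * w) = ad x u * w + u * ad x w := by
  simp only [ad_apply]
  noncomm_ring

theorem ad_sum {κ : Type*} (s : Finset κ) (x : κ → U) (u : U) :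
    ad (∑ k ∈ s, x k) u = ∑ k ∈ s, ad (x k) u := by
  simp only [ad_apply, Finset.sum_mul, Finset.mul_sum, Finset.sum_sub_distrib]

theorem ad_smul (c : ℂ) (x u : U) : ad (c • x) u = c • ad x u := by
  simp only [ad_apply, smul_mul_assoc, mul_smul_comm, smul_sub]

/-! ### Covariant families -/

/-- A family `X_{k,l}` on which the matrix units act as on matrix units. -/
def Covariant₂ (X : Matrix (Fin 6) (Fin 6) U) : Prop :=
  ∀ i j k l, ad (E i j) (X k l) = δ j k • X i l - δ i l • X k j

/-- A family `X_{a,b,c,d}` on which the matrix units act as on the tensors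
`e_a ⊗ e_b ⊗ e_c^* ⊗ e_d^*`. -/
def Covariant₄ (X : Fin 6 → Fin 6 → Fin 6 → Fin 6 → U) : Prop :=
  ∀ i j a b c d, ad (E i j) (X a b c d) =
    δ j a • X i b c d + δ j b • X a i c d - δ i c • X a b j d - δ i d • X a b c j

theorem covariant₂_E : Covariant₂ (Matrix.of E) := by
  intro i j k l
  have hs : ∀ p q r s : Fin 6, Matrix.single p q (1 : ℂ) * Matrix.single r s 1 =
      δ q r • Matrix.single p s 1 := by
    intro p q r s
    unfold δ
    split_ifs with hqr
    · subst hqr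
      rw [Matrix.single_mul_single_same, one_smul, one_mul]
    · rw [Matrix.single_mul_single_of_ne _ _ _ _ hqr, zero_smul]
  have hδ : δ l i = δ i l := by simp only [δ, eq_comm]
  simp only [ad_apply, Matrix.of_apply, E]
  rw [← inc_lie, ← traceless_lie, hs, hs, hδ]
  simp only [← incₗ_apply, map_sub, map_smul]

/-- The two terms in which the matrix unit acts on the contracted index cancel. -/
theorem Covariant₂.mul {X Y : Matrix (Fin 6) (Fin 6) U} (hX : Covariant₂ X)
    (hY : Covariant₂ Y) : Covariant₂ (X * Y) := by
  intro i j k l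
  simp only [Matrix.mul_apply, map_sum, ad_mul, hX i j, hY i j, sub_mul, mul_sub,
    smul_mul_assoc, mul_smul_comm, Finset.sum_add_distrib, Finset.sum_sub_distrib,
    sum_δ_smul, ← Finset.smul_sum]
  abel

/-- The powers of the matrix of matrix units. -/
def P (n : ℕ) : Matrix (Fin 6) (Fin 6) U := Matrix.of E ^ n

theorem P_one_apply (i j : Fin 6) : P 1 i j = E i j := by rw [P, pow_one, Matrix.of_apply]

theorem P_succ_apply (n : ℕ) (i j : Fin 6) : P (n + 1) i j = ∑ k, P n i k * E k j := by
  rw [P, pow_succ, Matrix.mul_apply]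
  rfl

theorem covariant₂_P (n : ℕ) : Covariant₂ (P (n + 1)) := by
  induction n with
  | zero => rw [P, pow_one]; exact covariant₂_E
  | succ n ih => rw [P, pow_succ]; exact ih.mul covariant₂_E

/-- The quadratic Casimir element. -/
def casimir : U := ∑ i, P 2 i i

/-- The trace of a covariant matrix is invariant. -/
theorem ad_casimir (i j : Fin 6) : ad (E i j) casimir = 0 := by
  simp only [casimir, map_sum, covariant₂_P 1 i j, Finset.sum_sub_distrib, sum_δ_smul, sub_self]

/-- The `2 × 2` minors of a pair of matrices. -/
def alt (X Y : Matrix (Fin 6) (Fin 6) U) (a b c d : Fin 6) : U :=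
  X a c * Y b d - X b c * Y a d - X a d * Y b c + X b d * Y a c

theorem covariant₄_alt {X Y : Matrix (Fin 6) (Fin 6) U} (hX : Covariant₂ X)
    (hY : Covariant₂ Y) : Covariant₄ (alt X Y) := by
  intro i j a b c d
  simp only [alt, map_add, map_sub, ad_mul, hX i j, hY i j, sub_mul, mul_sub,
    smul_mul_assoc, mul_smul_comm, smul_sub, smul_add]
  abel

/-- The family `T_{a,b,c,d}` that contains `v'` as one member. -/
def T (a b c d : Fin 6) : U :=
  (245 / 12 : ℂ) • alt (P 1) (P 1) a b c d - (14 : ℂ) • alt (P 1) (P 2) a b c d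
    + (4 / 3 : ℂ) • alt (P 1) (P 3) a b c d + alt (P 2) (P 2) a b c d
    - (4 / 15 : ℂ) • (casimir * alt (P 1) (P 1) a b c d)

theorem covariant₄_T : Covariant₄ T := by
  intro i j a b c d
  simp only [T, map_add, map_sub, map_smul, ad_mul, ad_casimir, zero_mul, zero_add,
    covariant₄_alt (covariant₂_P 0) (covariant₂_P 0) i j,
    covariant₄_alt (covariant₂_P 0) (covariant₂_P 1) i j,
    covariant₄_alt (covariant₂_P 0) (covariant₂_P 2) i j,
    covariant₄_alt (covariant₂_P 1) (covariant₂_P 1) i j, mul_add, mul_sub, mul_smul_comm]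
  module

theorem alt_swap_left (X Y : Matrix (Fin 6) (Fin 6) U) (a b c d : Fin 6) :
    alt X Y b a c d = -alt X Y a b c d := by
  simp only [alt]
  abel

theorem alt_swap_right (X Y : Matrix (Fin 6) (Fin 6) U) (a b c d : Fin 6) :
    alt X Y a b d c = -alt X Y a b c d := by
  simp only [alt]
  abel

theorem T_swap_left (a b c d : Fin 6) : T b a c d = -T a b c d := by
  simp only [T, alt_swap_left _ _ a b, mul_neg]
  module

theorem T_swap_right (a b c d : Fin 6) : T a b d c = -T a b c d := by
  simp only [T, alt_swap_right _ _ _ _ c d, mul_neg]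
  module

theorem T_self_left (a c d : Fin 6) : T a a c d = 0 := by
  have h : ∀ X Y : Matrix (Fin 6) (Fin 6) U, alt X Y a a c d = 0 := fun X Y => by
    simp only [alt]
    abel
  simp only [T, h, mul_zero, smul_zero, add_zero, sub_zero]

theorem T_self_right (a b c : Fin 6) : T a b c c = 0 := by
  have h : ∀ X Y : Matrix (Fin 6) (Fin 6) U, alt X Y a b c c = 0 := fun X Y => by
    simp only [alt]
    abel
  simp only [T, h, mul_zero, smul_zero, add_zero, sub_zero]

/-! ### Expansion of noncommutative polynomials in the matrix units -/

/-- The matrix unit with the code `n = 6 i + j`. -/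
def letter (n : ℕ) : U := E (Fin.ofNat 6 (n / 6)) (Fin.ofNat 6 n)

/-- The code of a matrix unit. -/
def code (i j : Fin 6) : ℕ := 6 * i.val + j.val

theorem letter_code (i j : Fin 6) : letter (code i j) = E i j := by
  rw [letter]
  congr 1 <;> apply Fin.ext <;> simp only [code, Fin.ofNat] <;> omega

/-- The product of the matrix units with the given codes. -/
def word : List ℕ → U
  | [] => 1
  | n :: w => letter n * word w

theorem word_append (u w : List ℕ) : word (u ++ w) = word u * word w := by
  induction u with
  | nil => rw [List.nil_append, word, one_mul]
  | cons n u ih => rw [List.cons_append, word, word, ih, mul_assoc]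

/-- An integral combination of words in the matrix units, as a list. -/
abbrev WordPoly : Type := List (ℤ × List ℕ)

namespace WordPoly

/-- The element of `U` given by a combination of words. -/
def eval : WordPoly → U
  | [] => 0
  | t :: q => t.1 • word t.2 + eval q

theorem eval_append (q r : WordPoly) : eval (q ++ r) = eval q + eval r := by
  induction q with
  | nil => rw [List.nil_append, eval, zero_add]
  | cons t q ih => rw [List.cons_append, eval, eval, ih, add_assoc]

/-- Multiplication by an integer. -/
def scale (c : ℤ) (q : WordPoly) : WordPoly := q.map fun t => (c * t.1, t.2)

theorem eval_scale (c : ℤ) (q : WordPoly) : eval (scale c q) = c • eval q := by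
  induction q with
  | nil => simp [scale, eval]
  | cons t q ih =>
    rw [scale, List.map_cons, eval, eval, smul_add, smul_smul, ← ih, scale]

/-- Multiplication by a term from the left. -/
def termMul (c : ℤ) (u : List ℕ) (q : WordPoly) : WordPoly := q.map fun t => (c * t.1, u ++ t.2)

theorem eval_termMul (c : ℤ) (u : List ℕ) (q : WordPoly) :
    eval (termMul c u q) = c • (word u * eval q) := by
  induction q with
  | nil => simp [termMul, eval]
  | cons t q ih =>
    rw [termMul, List.map_cons, eval, eval, mul_add, smul_add, mul_smul_comm, smul_smul, ← ih,
      word_append, termMul]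

/-- The product. -/
def mul : WordPoly → WordPoly → WordPoly
  | [], _ => []
  | t :: q, r => termMul t.1 t.2 r ++ mul q r

theorem eval_mul (q r : WordPoly) : eval (mul q r) = eval q * eval r := by
  induction q with
  | nil => rw [mul, eval, zero_mul]
  | cons t q ih => rw [mul, eval_append, eval_termMul, ih, eval, add_mul, smul_mul_assoc]

/-- Concatenation of `F k` for `k = 0, …, 5`. -/
def sum6 (F : Fin 6 → WordPoly) : WordPoly := F 0 ++ (F 1 ++ (F 2 ++ (F 3 ++ (F 4 ++ F 5))))

theorem eval_sum6 (F : Fin 6 → WordPoly) : eval (sum6 F) = ∑ k, eval (F k) := by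
  simp only [sum6, eval_append, Fin.sum_univ_six]
  abel

/-! ### Straightening of words to normal form -/

/-- The commutator of two matrix units. -/
def bracket (m n : ℕ) : WordPoly :=
  (bif (m % 6).beq (n / 6 % 6) then [(1, [6 * (m / 6 % 6) + n % 6])] else []) ++
    bif (m / 6 % 6).beq (n % 6) then [(-1, [6 * (n / 6 % 6) + m % 6])] else []

/-- `letter` reads every natural number through residues modulo 6, and so does `bracket`; hence no
bound on the codes is needed. -/
theorem letter_mul_letter (m n : ℕ) :
    letter m * letter n = letter n * letter m + eval (bracket m n) := by
  have hE := covariant₂_E (Fin.ofNat 6 (m / 6)) (Fin.ofNat 6 m) (Fin.ofNat 6 (n / 6))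
    (Fin.ofNat 6 n)
  have h₁ : letter (6 * (m / 6 % 6) + n % 6) = E (Fin.ofNat 6 (m / 6)) (Fin.ofNat 6 n) := by
    rw [letter]
    congr 1 <;> apply Fin.ext <;> simp only [Fin.ofNat] <;> omega
  have h₂ : letter (6 * (n / 6 % 6) + m % 6) = E (Fin.ofNat 6 (n / 6)) (Fin.ofNat 6 m) := by
    rw [letter]
    congr 1 <;> apply Fin.ext <;> simp only [Fin.ofNat] <;> omega
  rw [ad_apply, sub_eq_iff_eq_add'] at hE
  simp only [Matrix.of_apply] at hE
  rw [letter, letter, hE, bracket, eval_append]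
  congr 1
  have e₁ : (m % 6).beq (n / 6 % 6) = decide (Fin.ofNat 6 m = Fin.ofNat 6 (n / 6)) := by
    rw [Bool.eq_iff_iff, Nat.beq_eq, decide_eq_true_iff, Fin.ext_iff]
    rfl
  have e₂ : (m / 6 % 6).beq (n % 6) = decide (Fin.ofNat 6 (m / 6) = Fin.ofNat 6 n) := by
    rw [Bool.eq_iff_iff, Nat.beq_eq, decide_eq_true_iff, Fin.ext_iff]
    rfl
  rw [e₁, e₂, δ, δ, Bool.cond_decide, Bool.cond_decide, sub_eq_add_neg]
  congr 1
  · split_ifs <;> simp [eval, word, h₁]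
  · split_ifs <;> simp [eval, word, h₂]

/-- Rewrites the first letter `E_{6,6}` or the first descent of a word. -/
def stepWord : List ℕ → WordPoly
  | [] => [(1, [])]
  | m :: w =>
    bif m.beq 35 then
      [(-1, 0 :: w), (-1, 7 :: w), (-1, 14 :: w), (-1, 21 :: w), (-1, 28 :: w)]
    else
      match w with
      | [] => [(1, [m])]
      | n :: w' =>
        bif m.ble n then termMul 1 [m] (stepWord (n :: w'))
        else (1, n :: m :: w') :: mul (bracket m n) [(1, w')]

/-- The code 35 = 6 · 5 + 5 belongs to `E_{6,6}`, and the codes 0, 7, 14, 21, 28 to the other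
diagonal units; the six of them add up to zero. -/
theorem letter_last : letter 35 = -(letter 0 + letter 7 + letter 14 + letter 21 + letter 28) := by
  have hs := sum_E_self
  rw [Fin.sum_univ_six, add_comm] at hs
  exact eq_neg_of_add_eq_zero_left hs

theorem eval_stepWord : ∀ w : List ℕ, eval (stepWord w) = word w
  | [] => by simp [stepWord, eval, word]
  | [m] => by
    rw [stepWord]
    cases hm : m.beq 35
    · simp [eval, word]
    · simp only [cond_true, eval, word, Nat.eq_of_beq_eq_true hm, letter_last]
      noncomm_ring
  | m :: n :: w => by
    rw [stepWord]
    cases hm : m.beq 35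
    · cases hmn : m.ble n
      · simp only [cond_false, eval, eval_mul, word, ← mul_assoc, letter_mul_letter m n]
        noncomm_ring
      · simp only [cond_false, cond_true, eval_termMul, eval_stepWord (n :: w), one_smul, word,
          mul_one]
    · simp only [cond_true, eval, word, Nat.eq_of_beq_eq_true hm, letter_last]
      noncomm_ring

/-- Whether a word is weakly increasing without the letter `E_{6,6}`. -/
def isNormal : List ℕ → Bool
  | [] => true
  | m :: w =>
    bif m.beq 35 then false
    else
      match w with
      | [] => true
      | n :: w' => bif m.ble n then isNormal (n :: w') else false

/-- Equality of words. -/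
def sameWord : List ℕ → List ℕ → Bool
  | [], [] => true
  | m :: u, n :: w => bif m.beq n then sameWord u w else false
  | _, _ => false

theorem eq_of_sameWord : ∀ u w : List ℕ, sameWord u w = true → u = w
  | [], [], _ => rfl
  | m :: u, n :: w, huw => by
    rw [sameWord] at huw
    cases hmn : m.beq n
    · rw [hmn, cond_false] at huw
      exact absurd huw Bool.false_ne_true
    · rw [hmn, cond_true] at huw
      rw [Nat.eq_of_beq_eq_true hmn, eq_of_sameWord u w huw]

/-- Lexicographic comparison of words. -/
def lessWord : List ℕ → List ℕ → Bool
  | [], _ => true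
  | _, [] => false
  | m :: u, n :: w => bif m.beq n then lessWord u w else m.ble n

/-- A search tree of terms. -/
inductive Tree : Type
  | leaf : Tree
  | node : Tree → ℤ → List ℕ → Tree → Tree

/-- The sum of the terms in a tree. -/
def Tree.eval : Tree → U
  | .leaf => 0
  | .node l c w r => l.eval + c • word w + r.eval

/-- Adds a term to a tree. -/
def Tree.insert (c : ℤ) (w : List ℕ) : Tree → Tree
  | .leaf => .node .leaf c w .leaf
  | .node l d u r =>
    bif sameWord w u then .node l (c + d) u r
    else bif lessWord w u then .node (l.insert c w) d u r else .node l d u (r.insert c w)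

theorem Tree.eval_insert (c : ℤ) (w : List ℕ) (t : Tree) :
    (t.insert c w).eval = c • word w + t.eval := by
  induction t with
  | leaf => simp [Tree.insert, Tree.eval]
  | node l d u r hl hr =>
    rw [Tree.insert]
    cases hs : sameWord w u
    · cases lessWord w u
      · rw [cond_false, cond_false, Tree.eval, Tree.eval, hr]
        abel
      · rw [cond_false, cond_true, Tree.eval, Tree.eval, hl]
        abel
    · rw [cond_true, Tree.eval, Tree.eval, eq_of_sameWord w u hs, add_smul]
      abel

/-- Adds the terms of a combination to a tree, after at most `n` rewriting steps for each. -/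
def expand : ℕ → WordPoly → Tree → Tree
  | 0, q, t => q.foldr (fun s t => t.insert s.1 s.2) t
  | n + 1, q, t =>
    q.foldr (fun s t => bif isNormal s.2 then t.insert s.1 s.2
      else expand n (scale s.1 (stepWord s.2)) t) t

/-- Every rewriting step is an identity in `U`, so this holds for any bound `n`: when the bound is
exhausted, words enter the tree in whatever form they have reached. -/
theorem eval_expand (n : ℕ) : ∀ q t, (expand n q t).eval = eval q + t.eval := by
  induction n with
  | zero =>
    intro q t
    induction q with
    | nil => rw [expand, List.foldr_nil, eval, zero_add]
    | cons s q ih =>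
      rw [expand] at ih ⊢
      rw [List.foldr_cons, Tree.eval_insert, ih, eval, add_assoc]
  | succ n hn =>
    intro q t
    induction q with
    | nil => rw [expand, List.foldr_nil, eval, zero_add]
    | cons s q ih =>
      rw [expand] at ih ⊢
      rw [List.foldr_cons]
      cases isNormal s.2
      · rw [cond_false, hn, ih, eval_scale, eval_stepWord, eval, add_assoc]
      · rw [cond_true, Tree.eval_insert, ih, eval, add_assoc]

/-- Whether a coefficient vanishes. -/
def isZeroInt : ℤ → Bool
  | .ofNat n => n.beq 0
  | .negSucc _ => false

theorem eq_zero_of_isZeroInt {c : ℤ} (hc : isZeroInt c = true) : c = 0 := by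
  cases c with
  | ofNat n => rw [isZeroInt] at hc; rw [Nat.eq_of_beq_eq_true hc]; rfl
  | negSucc n => exact absurd hc Bool.false_ne_true

/-- Whether all coefficients of a tree vanish. -/
def Tree.vanishes : Tree → Bool
  | .leaf => true
  | .node l c _ r => bif isZeroInt c then (bif l.vanishes then r.vanishes else false) else false

theorem Tree.eval_eq_zero {t : Tree} (ht : t.vanishes = true) : t.eval = 0 := by
  induction t with
  | leaf => rfl
  | node l c w r hl hr =>
    rw [Tree.vanishes] at ht
    cases hc : isZeroInt c
    · rw [hc] at ht
      exact absurd ht Bool.false_ne_true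
    · cases hv : l.vanishes
      · rw [hc, hv] at ht
        exact absurd ht Bool.false_ne_true
      · rw [hc, hv] at ht
        rw [Tree.eval, hl hv, hr ht, eq_zero_of_isZeroInt hc, zero_smul, add_zero, add_zero]

/-- Only this direction is needed, so the linear independence of normal words
(Poincaré–Birkhoff–Witt) plays no role. -/
theorem eval_eq_zero_of_vanishes {n : ℕ} {q : WordPoly}
    (hq : (expand n q .leaf).vanishes = true) : eval q = 0 := by
  have := eval_expand n q .leaf
  rwa [Tree.eval_eq_zero hq, Tree.eval, add_zero, eq_comm] at this

end WordPoly

namespace WordPoly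

/-! ### Representation of elements by combinations of words -/

/-- `x` is represented by `q`. -/
def Rep (x : U) (q : WordPoly) : Prop := x = eval q

/-- `60 x` is represented by `q`. -/
def RepSixty (x : U) (q : WordPoly) : Prop := (60 : ℂ) • x = eval q

theorem Rep.mul {x y : U} {q r : WordPoly} (hx : Rep x q) (hy : Rep y r) :
    Rep (x * y) (WordPoly.mul q r) := by
  rw [Rep, eval_mul, ← hx, ← hy]

theorem Rep.add {x y : U} {q r : WordPoly} (hx : Rep x q) (hy : Rep y r) :
    Rep (x + y) (q ++ r) := by
  rw [Rep, eval_append, ← hx, ← hy]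

theorem Rep.sub {x y : U} {q r : WordPoly} (hx : Rep x q) (hy : Rep y r) :
    Rep (x - y) (q ++ scale (-1) r) := by
  rw [Rep, eval_append, eval_scale, ← hx, ← hy, neg_one_zsmul, sub_eq_add_neg]

theorem Rep.sum {x : Fin 6 → U} {q : Fin 6 → WordPoly} (hx : ∀ k, Rep (x k) (q k)) :
    Rep (∑ k, x k) (sum6 q) := by
  rw [Rep, eval_sum6]
  exact Finset.sum_congr rfl fun k _ => hx k

theorem rep_E (i j : Fin 6) : Rep (E i j) [(1, [code i j])] := by
  simp [Rep, eval, word, letter_code]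

theorem RepSixty.add {x y : U} {q r : WordPoly} (hx : RepSixty x q) (hy : RepSixty y r) :
    RepSixty (x + y) (q ++ r) := by
  rw [RepSixty, eval_append, ← hx, ← hy, smul_add]

theorem RepSixty.sub {x y : U} {q r : WordPoly} (hx : RepSixty x q) (hy : RepSixty y r) :
    RepSixty (x - y) (q ++ scale (-1) r) := by
  rw [RepSixty, eval_append, eval_scale, ← hx, ← hy, neg_one_zsmul, smul_sub, sub_eq_add_neg]

theorem repSixty_smul {c : ℂ} (n : ℕ) (hc : 60 * c = n) {x : U} {q : WordPoly} (hx : Rep x q) :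
    RepSixty (c • x) (scale n q) := by
  rw [RepSixty, eval_scale, ← hx, smul_smul, hc, natCast_zsmul, Nat.cast_smul_eq_nsmul]

theorem Rep.sixty {x : U} {q : WordPoly} (hx : Rep x q) : RepSixty x (scale 60 q) := by
  rw [RepSixty, eval_scale, ← hx]
  exact ofNat_smul_eq_nsmul ℂ 60 x

/-- The number 60 is a common denominator of the coefficients of `v'` and of `T`, so the comparison
of the two runs over the integers. -/
theorem eq_of_repSixty {x y : U} {q r : WordPoly} (hx : RepSixty x q) (hy : RepSixty y r)
    {n : ℕ} (hqr : (expand n (q ++ scale (-1) r) .leaf).vanishes = true) : x = y := by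
  have h : (60 : ℂ) • (x - y) = 0 := by rw [hx.sub hy, eval_eq_zero_of_vanishes hqr]
  exact sub_eq_zero.1 ((smul_eq_zero_iff_right (by norm_num)).1 h)

end WordPoly

/-! ### The generator as an entry of the covariant family -/

open WordPoly

theorem single_eq_E {i j : Fin 6} (hij : i ≠ j) :
    inc (LieAlgebra.SpecialLinear.single i j hij 1) = E i j := by
  conv_lhs => rw [← traceless_coe (LieAlgebra.SpecialLinear.single i j hij 1),
    LieAlgebra.SpecialLinear.val_single]
  rfl

theorem e_eq (i j : ℕ) (hij : ix i ≠ ix j) : e i j hij = E (ix i) (ix j) := single_eq_E hij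

theorem f_eq (i j : ℕ) (hij : ix j ≠ ix i) : f i j hij = E (ix j) (ix i) := single_eq_E hij

theorem h_eq (i : ℕ) : h i = E (ix i) (ix i) - E (ix (i + 1)) (ix (i + 1)) := by
  rw [h, ← traceless_coe (coroot i), coroot, LieAlgebra.SpecialLinear.val_singleSubSingle,
    map_sub, ← incₗ_apply, map_sub]
  rfl

namespace WordPoly

theorem rep_e (i j : ℕ) (hij : ix i ≠ ix j) : Rep (e i j hij) [(1, [code (ix i) (ix j)])] := by
  rw [e_eq]
  exact rep_E _ _

theorem rep_f (i j : ℕ) (hij : ix j ≠ ix i) : Rep (f i j hij) [(1, [code (ix j) (ix i)])] := by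
  rw [f_eq]
  exact rep_E _ _

theorem rep_h (i : ℕ) : Rep (h i) [(1, [code (ix i) (ix i)]),
    (-1, [code (ix (i + 1)) (ix (i + 1))])] := by
  rw [h_eq]
  exact (rep_E _ _).sub (rep_E _ _)

/-- Words for the entries of the powers of the matrix of matrix units. -/
def power : ℕ → Fin 6 → Fin 6 → WordPoly
  | 0, i, j => [(1, [code i j])]
  | n + 1, i, j => sum6 fun k => mul (power n i k) [(1, [code k j])]

theorem rep_P (n : ℕ) : ∀ i j, Rep (P (n + 1) i j) (power n i j) := by
  induction n with
  | zero => intro i j; rw [P_one_apply]; exact rep_E i j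
  | succ n ih =>
    intro i j
    rw [P_succ_apply]
    exact Rep.sum fun k => (ih i k).mul (rep_E k j)

/-- Words for the minors. -/
def minor (m n : ℕ) (a b c d : Fin 6) : WordPoly :=
  ((mul (power m a c) (power n b d) ++ scale (-1) (mul (power m b c) (power n a d))) ++
    scale (-1) (mul (power m a d) (power n b c))) ++ mul (power m b d) (power n a c)

theorem rep_alt (m n : ℕ) (a b c d : Fin 6) :
    Rep (alt (P (m + 1)) (P (n + 1)) a b c d) (minor m n a b c d) :=
  ((((rep_P m _ _).mul (rep_P n _ _)).sub ((rep_P m _ _).mul (rep_P n _ _))).sub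
    ((rep_P m _ _).mul (rep_P n _ _))).add ((rep_P m _ _).mul (rep_P n _ _))

theorem rep_casimir : Rep casimir (sum6 fun i => power 1 i i) := Rep.sum fun i => rep_P 1 i i

end WordPoly

set_option maxRecDepth 10000 in
set_option maxHeartbeats 1000000 in
/-- The generator `v'` is a member of the covariant family `T`. -/
theorem v'_eq_T : v' = T 0 1 4 5 := by
  -- The value 12 bounds the rewriting steps for each word; too small a value could only make the
  -- final check fail.
  apply eq_of_repSixty (n := 12)
  case hx =>
    unfold v'
    -- The integers are 60 times the coefficients that occur in `v'`; terms without a coefficient go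
    -- through `Rep.sixty`.
    have c1 := @repSixty_smul (7 / 2) 210 (by norm_num)
    have c2 := @repSixty_smul (4 / 3) 80 (by norm_num)
    have c3 := @repSixty_smul (1 / 3) 20 (by norm_num)
    have c4 := @repSixty_smul (5 / 3) 100 (by norm_num)
    have c5 := @repSixty_smul (3) 180 (by norm_num)
    have c6 := @repSixty_smul (2) 120 (by norm_num)
    have c7 := @repSixty_smul (4 / 15) 16 (by norm_num)
    have c8 := @repSixty_smul (8 / 15) 32 (by norm_num)
    have c9 := @repSixty_smul (16 / 15) 64 (by norm_num)
    have c10 := @repSixty_smul (12 / 5) 144 (by norm_num)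
    have c11 := @repSixty_smul (2 / 3) 40 (by norm_num)
    have c12 := @repSixty_smul (2 / 5) 24 (by norm_num)
    have c13 := @repSixty_smul (2 / 15) 8 (by norm_num)
    repeat' first
      | with_reducible apply RepSixty.add
      | with_reducible apply RepSixty.sub
      | with_reducible apply c1
      | with_reducible apply c2
      | with_reducible apply c3
      | with_reducible apply c4
      | with_reducible apply c5
      | with_reducible apply c6
      | with_reducible apply c7
      | with_reducible apply c8
      | with_reducible apply c9
      | with_reducible apply c10
      | with_reducible apply c11
      | with_reducible apply c12
      | with_reducible apply c13
      | with_reducible apply rep_e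
      | with_reducible apply rep_f
      | with_reducible apply rep_h
      | with_reducible apply Rep.mul
      | with_reducible apply Rep.sixty
  case hy =>
    exact ((((repSixty_smul 1225 (by norm_num) (rep_alt 0 0 0 1 4 5)).sub
      (repSixty_smul 840 (by norm_num) (rep_alt 0 1 0 1 4 5))).add
      (repSixty_smul 80 (by norm_num) (rep_alt 0 2 0 1 4 5))).add (rep_alt 1 1 0 1 4 5).sixty).sub
      (repSixty_smul 16 (by norm_num) (rep_casimir.mul (rep_alt 0 0 0 1 4 5)))
  case hqr => decide +kernel

/-! ### The module generated by `v'` -/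

theorem sum_δ_mul (i : Fin 6) (x : Fin 6 → ℂ) : ∑ k, δ i k * x k = x i := sum_δ_smul i x

/-- The contractions of a coefficient tensor `x_{a,b,c,d}` of an upper with a lower index vanish. -/
structure IsTraceless (x : Fin 6 → Fin 6 → Fin 6 → Fin 6 → ℂ) : Prop where
  fst_fst : ∀ b d, ∑ a, x a b a d = 0
  fst_snd : ∀ b c, ∑ a, x a b c a = 0
  snd_fst : ∀ a d, ∑ b, x a b b d = 0
  snd_snd : ∀ a c, ∑ b, x a b c b = 0

/-- The combination of the `T_{a,b,c,d}` with given coefficients. -/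
def comb (x : Fin 6 → Fin 6 → Fin 6 → Fin 6 → ℂ) : U :=
  ∑ a, ∑ b, ∑ c, ∑ d, x a b c d • T a b c d

/-- The action of a matrix unit on coefficient tensors. -/
def unitAct (i j : Fin 6) (x : Fin 6 → Fin 6 → Fin 6 → Fin 6 → ℂ) (a b c d : Fin 6) : ℂ :=
  δ i a * x j b c d + δ i b * x a j c d - δ j c * x a b i d - δ j d * x a b c i

/-- Covariance moves the action from the `T a b c d` to their coefficients: in each of the four
terms one index is renamed in the sum. -/
theorem ad_comb (i j : Fin 6) (x : Fin 6 → Fin 6 → Fin 6 → Fin 6 → ℂ) :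
    ad (E i j) (comb x) = comb (unitAct i j x) := by
  have hl : ∀ a b c d, x a b c d • ad (E i j) (T a b c d) =
      δ j a • x a b c d • T i b c d + δ j b • x a b c d • T a i c d
        - δ i c • x a b c d • T a b j d - δ i d • x a b c d • T a b c j := by
    intro a b c d
    rw [covariant₄_T i j a b c d]
    module
  simp only [comb, map_sum, map_smul, hl, unitAct, sub_smul, add_smul, mul_smul,
    Finset.sum_add_distrib, Finset.sum_sub_distrib, ← Finset.smul_sum, sum_δ_smul]

theorem IsTraceless.unitAct {x : Fin 6 → Fin 6 → Fin 6 → Fin 6 → ℂ} (hx : IsTraceless x)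
    (i j : Fin 6) : IsTraceless (unitAct i j x) where
  fst_fst b d := by
    simp only [SL6.unitAct, Finset.sum_add_distrib, Finset.sum_sub_distrib, ← Finset.mul_sum,
      sum_δ_mul, hx.fst_fst]
    ring
  fst_snd b d := by
    simp only [SL6.unitAct, Finset.sum_add_distrib, Finset.sum_sub_distrib, ← Finset.mul_sum,
      sum_δ_mul, hx.fst_snd]
    ring
  snd_fst b d := by
    simp only [SL6.unitAct, Finset.sum_add_distrib, Finset.sum_sub_distrib, ← Finset.mul_sum,
      sum_δ_mul, hx.snd_fst]
    ring
  snd_snd b d := by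
    simp only [SL6.unitAct, Finset.sum_add_distrib, Finset.sum_sub_distrib, ← Finset.mul_sum,
      sum_δ_mul, hx.snd_snd]
    ring

/-- The combinations of the `T_{a,b,c,d}` with traceless coefficients. -/
def tracelessSpan : Submodule ℂ U where
  carrier := {u | ∃ x, IsTraceless x ∧ u = comb x}
  add_mem' {u w} := by
    rintro ⟨x, hx, rfl⟩ ⟨y, hy, rfl⟩
    refine ⟨fun a b c d => x a b c d + y a b c d, ⟨?_, ?_, ?_, ?_⟩, ?_⟩
    · intro b d; rw [Finset.sum_add_distrib, hx.fst_fst, hy.fst_fst, add_zero]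
    · intro b d; rw [Finset.sum_add_distrib, hx.fst_snd, hy.fst_snd, add_zero]
    · intro b d; rw [Finset.sum_add_distrib, hx.snd_fst, hy.snd_fst, add_zero]
    · intro b d; rw [Finset.sum_add_distrib, hx.snd_snd, hy.snd_snd, add_zero]
    · simp only [comb, add_smul, Finset.sum_add_distrib]
  zero_mem' := ⟨fun _ _ _ _ => 0, ⟨by simp, by simp, by simp, by simp⟩, by simp [comb]⟩
  smul_mem' t u := by
    rintro ⟨x, hx, rfl⟩
    refine ⟨fun a b c d => t * x a b c d, ⟨?_, ?_, ?_, ?_⟩, ?_⟩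
    · intro b d; rw [← Finset.mul_sum, hx.fst_fst, mul_zero]
    · intro b d; rw [← Finset.mul_sum, hx.fst_snd, mul_zero]
    · intro b d; rw [← Finset.mul_sum, hx.snd_fst, mul_zero]
    · intro b d; rw [← Finset.mul_sum, hx.snd_snd, mul_zero]
    · simp only [comb, mul_smul, Finset.smul_sum]

theorem R_le_tracelessSpan : R ≤ tracelessSpan := by
  -- The tensor with the single entry 1 at `(0, 1, 4, 5)` represents `v'`. Its contractions vanish
  -- because the upper indices 0, 1 differ from the lower indices 4, 5.
  refine sInf_le ⟨⟨fun a b c d => δ 0 a * (δ 1 b * (δ 4 c * δ 5 d)), ?_, ?_⟩, ?_⟩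
  · constructor <;> intro p q
    · rw [sum_δ_mul, δ_ne (by decide : (4 : Fin 6) ≠ 0)]; ring
    · rw [sum_δ_mul, δ_ne (by decide : (5 : Fin 6) ≠ 0)]; ring
    · rw [← Finset.mul_sum, sum_δ_mul, δ_ne (by decide : (4 : Fin 6) ≠ 1)]; ring
    · rw [← Finset.mul_sum, sum_δ_mul, δ_ne (by decide : (5 : Fin 6) ≠ 1)]; ring
  · simp only [comb, mul_smul, ← Finset.smul_sum, sum_δ_smul, v'_eq_T]
  · rintro A u ⟨x, hx, rfl⟩
    change ad (inc A) (comb x) ∈ tracelessSpan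
    rw [inc_eq_sum, ad_sum]
    refine Submodule.sum_mem _ fun i _ => ?_
    rw [ad_sum]
    refine Submodule.sum_mem _ fun j _ => ?_
    rw [ad_smul, ad_comb]
    exact Submodule.smul_mem _ _ ⟨_, hx.unitAct i j, rfl⟩

theorem traceless_single_mem (i : Fin 6) : traceless (Matrix.single i i 1) ∈ cartan := by
  intro a b hab
  rw [coe_traceless, Matrix.sub_apply, Matrix.single_apply_of_ne, Matrix.smul_apply,
    Matrix.smul_apply, Matrix.one_apply_ne hab, smul_zero, smul_zero, sub_zero]
  rintro ⟨rfl, rfl⟩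
  exact hab rfl

/-- The diagonal `E i i` lie in the image of `𝔥` and span it. -/
theorem mem_R0_iff (r : U) : r ∈ R0 ↔ r ∈ R ∧ ∀ i, ad (E i i) r = 0 := by
  constructor
  · rintro ⟨hr, h0⟩
    exact ⟨hr, fun i => h0 _ (traceless_single_mem i)⟩
  · rintro ⟨hr, h0⟩
    refine ⟨hr, fun H hH => ?_⟩
    change ad (inc H) r = 0
    rw [inc_eq_sum, ad_sum]
    refine Finset.sum_eq_zero fun i _ => ?_
    rw [ad_sum]
    refine Finset.sum_eq_zero fun j _ => ?_
    rw [ad_smul]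
    by_cases hij : i = j
    · rw [← hij, h0, smul_zero]
    · rw [hH hij, zero_smul]

theorem ad_E_self_T (i a b c d : Fin 6) :
    ad (E i i) (T a b c d) = (δ i a + δ i b - δ i c - δ i d) • T a b c d := by
  rw [covariant₄_T]
  have key : ∀ (p : Fin 6) (X : Fin 6 → U), δ i p • X i = δ i p • X p := by
    intro p X
    by_cases hp : i = p
    · rw [hp]
    · rw [δ_ne hp, zero_smul, zero_smul]
  rw [key a fun k => T k b c d, key b fun k => T a k c d, key c fun k => T a b k d,
    key d fun k => T a b c k]
  module

/-- A regular element of the Cartan subalgebra. -/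
def regular : U := ∑ i : Fin 6, (2 ^ i.val : ℂ) • E i i

/-- The weight of `T_{a,b,c,d}` for `regular`. -/
def weight (a b c d : Fin 6) : ℂ := 2 ^ a.val + 2 ^ b.val - 2 ^ c.val - 2 ^ d.val

theorem ad_regular_T (a b c d : Fin 6) :
    ad regular (T a b c d) = weight a b c d • T a b c d := by
  have hδ : ∀ p : Fin 6, ∑ i : Fin 6, (2 ^ i.val : ℂ) * δ i p = 2 ^ p.val := by
    intro p
    simp [δ]
  simp only [regular, ad_sum, ad_smul, ad_E_self_T, smul_smul]
  rw [← Finset.sum_smul]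
  simp only [mul_sub, mul_add, Finset.sum_sub_distrib, Finset.sum_add_distrib, hδ, weight]

/-- A sum of two distinct powers of 2 determines the two exponents, by uniqueness of binary
expansions. This is why `regular` has the powers of 2 as its coefficients. -/
theorem eq_or_eq_of_weight_eq_zero {a b c d : Fin 6} (hab : a ≠ b) (hcd : c ≠ d)
    (hw : weight a b c d = 0) : c = a ∧ d = b ∨ c = b ∧ d = a := by
  have hn : 2 ^ a.val + 2 ^ b.val = 2 ^ c.val + 2 ^ d.val := by
    have : ((2 ^ a.val + 2 ^ b.val : ℕ) : ℂ) = (2 ^ c.val + 2 ^ d.val : ℕ) := by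
      push_cast
      rw [weight] at hw
      linear_combination hw
    exact_mod_cast this
  clear hw
  revert a b c d
  decide +kernel

/-- The difference of the two sides lies in the kernel of `ad regular` and also in the sum of the
other eigenspaces. Since eigenspaces are independent, it vanishes. The minus sign comes from `T a b
b a = -T a b a b`. -/
theorem eq_sum_of_ad_regular_eq_zero (x : Fin 6 → Fin 6 → Fin 6 → Fin 6 → ℂ)
    (hx : ad regular (comb x) = 0) :
    comb x = ∑ a, ∑ b, (x a b a b - x a b b a) • T a b a b := by
  set F : Module.End ℂ U := ad regular with hF
  have hmem : ∀ a b c d, T a b c d ∈ F.eigenspace (weight a b c d) := fun a b c d =>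
    Module.End.mem_eigenspace_iff.2 (ad_regular_T a b c d)
  rw [← sub_eq_zero]
  have hdis := Module.End.eigenspaces_iSupIndep F (0 : ℂ)
  refine Submodule.disjoint_def.1 hdis _ ?_ ?_
  · refine Submodule.sub_mem _ (Module.End.mem_eigenspace_iff.2 (by rw [hx, zero_smul])) ?_
    refine Submodule.sum_mem _ fun a _ => Submodule.sum_mem _ fun b _ => Submodule.smul_mem _ _ ?_
    have := hmem a b a b
    rwa [weight, show (2 ^ a.val + 2 ^ b.val - 2 ^ a.val - 2 ^ b.val : ℂ) = 0 by ring] at this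
  -- The factor `1 - δ a c * δ b d - δ b c * δ a d` removes exactly the terms of weight zero, apart
  -- from entries of `T` that vanish by antisymmetry.
  · have hab : ∀ a b, (∑ c, ∑ d, x a b c d • T a b c d) - (x a b a b - x a b b a) • T a b a b =
        ∑ c, ∑ d, (1 - δ a c * δ b d - δ b c * δ a d) • x a b c d • T a b c d := by
      intro a b
      simp only [sub_smul, one_smul, Finset.sum_sub_distrib, mul_smul, ← Finset.smul_sum,
        sum_δ_smul]
      rw [T_swap_right a b a b]
      module
    rw [comb, ← Finset.sum_sub_distrib]
    refine Submodule.sum_mem _ fun a _ => ?_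
    rw [← Finset.sum_sub_distrib]
    refine Submodule.sum_mem _ fun b _ => ?_
    rw [hab]
    refine Submodule.sum_mem _ fun c _ => Submodule.sum_mem _ fun d _ => ?_
    by_cases h₁ : a = b
    · rw [h₁, T_self_left, smul_zero, smul_zero]
      exact Submodule.zero_mem _
    by_cases h₂ : c = d
    · rw [h₂, T_self_right, smul_zero, smul_zero]
      exact Submodule.zero_mem _
    by_cases hw : weight a b c d = 0
    · have h0 : 1 - δ a c * δ b d - δ b c * δ a d = 0 := by
        rcases eq_or_eq_of_weight_eq_zero h₁ h₂ hw with ⟨rfl, rfl⟩ | ⟨rfl, rfl⟩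
        · rw [δ_self, δ_self, δ_ne h₁]; ring
        · rw [δ_self, δ_self, δ_ne h₁]; ring
      rw [h0, zero_smul]
      exact Submodule.zero_mem _
    · exact Submodule.smul_mem _ _ (Submodule.smul_mem _ _
        (Submodule.mem_iSup_of_mem _ (Submodule.mem_iSup_of_mem hw (hmem a b c d))))

theorem T_swap_both (a b : Fin 6) : T b a b a = T a b a b := by
  rw [T_swap_left, T_swap_right, neg_neg]

/-- The zero weight vectors of `R` are combinations of the `T_{a,b,a,b}` whose coefficients form a
symmetric matrix with zero row sums. -/
theorem exists_of_mem_R0 {r : U} (hr : r ∈ R0) : ∃ y : Fin 6 → Fin 6 → ℂ,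
    (∀ a b, y a b = y b a) ∧ (∀ a, y a a = 0) ∧ (∀ a, ∑ b, y a b = 0) ∧
      r = ∑ a, ∑ b, y a b • T a b a b := by
  rw [mem_R0_iff] at hr
  obtain ⟨x, hx, rfl⟩ := R_le_tracelessSpan hr.1
  have h0 : ad regular (comb x) = 0 := by
    rw [regular, ad_sum]
    exact Finset.sum_eq_zero fun i _ => by rw [ad_smul, hr.2, smul_zero]
  -- Since `T b a b a = T a b a b`, the coefficients may be averaged over the exchange of `a` and
  -- `b`. A row sum then splits into the four kinds of contractions, all of which vanish.
  refine ⟨fun a b => (1 / 2) * (x a b a b - x a b b a + (x b a b a - x b a a b)), fun a b => ?_,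
    fun a => ?_, fun a => ?_, ?_⟩
  · ring
  · ring
  · rw [← Finset.mul_sum, Finset.sum_add_distrib, Finset.sum_sub_distrib, Finset.sum_sub_distrib,
      hx.snd_snd, hx.snd_fst, hx.fst_fst, hx.fst_snd]
    ring
  · rw [eq_sum_of_ad_regular_eq_zero x h0]
    have hs : ∑ a, ∑ b, (x b a b a - x b a a b) • T a b a b =
        ∑ a, ∑ b, (x a b a b - x a b b a) • T a b a b := by
      rw [Finset.sum_comm]
      refine Finset.sum_congr rfl fun a _ => Finset.sum_congr rfl fun b _ => ?_
      rw [T_swap_both]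
    simp only [mul_smul, add_smul, ← Finset.smul_sum, Finset.sum_add_distrib, hs]
    module

/-! ### Zero weight vectors of `R` -/

theorem R_isStable {u : U} (hu : u ∈ R) (i j : Fin 6) : ad (E i j) u ∈ R := by
  rw [R, Submodule.mem_sInf] at hu ⊢
  intro N hN
  exact hN.2 _ u (hu N hN)

/-- The unit `E i a` replaces the index `a` by `i`; the hypotheses make its other three terms
vanish. The three analogues below change the other indices, the lower ones with a minus sign. -/
theorem T_mem_R_of_fst {a b c d : Fin 6} (hT : T a b c d ∈ R) (i : Fin 6) (hab : a ≠ b)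
    (hic : i ≠ c) (hid : i ≠ d) : T i b c d ∈ R := by
  have := R_isStable hT i a
  rwa [covariant₄_T, δ_self, δ_ne hab, δ_ne hic, δ_ne hid, one_smul, zero_smul, zero_smul,
    zero_smul, add_zero, sub_zero, sub_zero] at this

theorem T_mem_R_of_snd {a b c d : Fin 6} (hT : T a b c d ∈ R) (i : Fin 6) (hab : b ≠ a)
    (hic : i ≠ c) (hid : i ≠ d) : T a i c d ∈ R := by
  have := R_isStable hT i b
  rwa [covariant₄_T, δ_self, δ_ne hab, δ_ne hic, δ_ne hid, one_smul, zero_smul, zero_smul,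
    zero_smul, zero_add, sub_zero, sub_zero] at this

theorem T_mem_R_of_trd {a b c d : Fin 6} (hT : T a b c d ∈ R) (j : Fin 6) (hcd : c ≠ d)
    (hja : j ≠ a) (hjb : j ≠ b) : T a b j d ∈ R := by
  have := R_isStable hT c j
  rwa [covariant₄_T, δ_self, δ_ne hcd, δ_ne hja, δ_ne hjb, one_smul, zero_smul, zero_smul,
    zero_smul, sub_zero, zero_add, zero_sub, neg_mem_iff] at this

theorem T_mem_R_of_fth {a b c d : Fin 6} (hT : T a b c d ∈ R) (j : Fin 6) (hcd : d ≠ c)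
    (hja : j ≠ a) (hjb : j ≠ b) : T a b c j ∈ R := by
  have := R_isStable hT d j
  rwa [covariant₄_T, δ_self, δ_ne hcd, δ_ne hja, δ_ne hjb, one_smul, zero_smul, zero_smul,
    zero_smul, sub_zero, zero_add, zero_sub, neg_mem_iff] at this

/-- The combination of the `T_{a,b,a,b}` attached to a `4`-cycle. -/
def cycle (a b c d : Fin 6) : U := T a b a b - T c b c b - T a d a d + T c d c d

theorem cycle_mem_R0 {a b c d : Fin 6} (hT : T a b c d ∈ R) (hab : a ≠ b) (had : a ≠ d)
    (hbc : b ≠ c) (hcd : c ≠ d) : cycle a b c d ∈ R0 := by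
  rw [mem_R0_iff]
  constructor
  -- The unit `E c a` gives `T c b c d - T a b a d`, and `E d b` then turns each of these into a
  -- difference of two diagonal entries.
  · have key : ad (E d b) (ad (E c a) (T a b c d)) = cycle a b c d := by
      simp only [covariant₄_T c a, covariant₄_T d b, map_sub, δ_self, δ_ne hab,
        δ_ne hbc, δ_ne hcd, δ_ne hab.symm, δ_ne had.symm, δ_ne hcd.symm, one_smul, zero_smul,
        add_zero, zero_add, sub_zero, cycle]
      abel
    rw [← key]
    exact R_isStable (R_isStable hT c a) d b
  · intro i
    simp only [cycle, map_add, map_sub, ad_E_self_T]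
    module

/-! ### Action on highest weight vectors -/

section Highest

variable {M : Type*} [AddCommGroup M] [Module U M]

/-- `x` acts on `v` as the scalar `c`. -/
def Acts (v : M) (x : U) (c : ℂ) : Prop := x • v = algebraMap ℂ U c • v

variable {v : M} {x y : U} {c d : ℂ}

theorem Acts.add (hx : Acts v x c) (hy : Acts v y d) : Acts v (x + y) (c + d) := by
  rw [Acts, add_smul, hx, hy, map_add, add_smul]

theorem Acts.sub (hx : Acts v x c) (hy : Acts v y d) : Acts v (x - y) (c - d) := by
  rw [Acts, sub_smul, hx, hy, map_sub, sub_smul]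

theorem Acts.mul (hx : Acts v x c) (hy : Acts v y d) : Acts v (x * y) (c * d) := by
  rw [Acts, mul_smul, hy, ← mul_smul, ← Algebra.commutes, mul_smul, hx, ← mul_smul, ← map_mul,
    mul_comm]

theorem Acts.smul (t : ℂ) (hx : Acts v x c) : Acts v (t • x) (t * c) := by
  rw [Acts, Algebra.smul_def, mul_smul, hx, ← mul_smul, ← map_mul]

theorem acts_zero (v : M) : Acts v (0 : U) 0 := by rw [Acts, map_zero]

theorem Acts.mul_zero (x : U) (hy : Acts v y 0) : Acts v (x * y) 0 := by
  rw [Acts, mul_smul, hy, map_zero, zero_smul, smul_zero]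

theorem Acts.sum {κ : Type*} (s : Finset κ) {x : κ → U} {c : κ → ℂ}
    (hx : ∀ k ∈ s, Acts v (x k) (c k)) : Acts v (∑ k ∈ s, x k) (∑ k ∈ s, c k) := by
  rw [Acts, Finset.sum_smul, map_sum, Finset.sum_smul]
  exact Finset.sum_congr rfl hx

/-- `v` is annihilated by the `E_{i,j}` with `i < j`, and `E_{i,i}` acts on it as `ν_i`. -/
structure IsHighest (ν : Fin 6 → ℂ) (v : M) : Prop where
  raising : ∀ i j, i < j → Acts v (E i j) 0
  weight : ∀ i, Acts v (E i i) (ν i)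

/-- The scalar as which the `i`-th diagonal entry of the power `n + 1` of the matrix of matrix units
acts on a highest weight vector. -/
def diagCoeff (ν : Fin 6 → ℂ) : ℕ → Fin 6 → ℂ
  | 0, i => ν i
  | n + 1, i => ∑ k, if k < i then 0 else if k = i then diagCoeff ν n i * ν i
      else diagCoeff ν n i - diagCoeff ν n k

variable {ν : Fin 6 → ℂ}

/-- Expand the last factor of the power as `∑ k, P (n + 1) i k * E k j`. The terms with `k < j` end
in a raising operator, and `k = j` contributes a weight. For `k > j` the two factors are
interchanged; the entry `P (n + 1) i k` above the diagonal then kills `v` by induction, and the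
commutator remains. -/
theorem IsHighest.acts_P (hv : IsHighest ν v) (n : ℕ) :
    ∀ i j, i ≤ j → Acts v (P (n + 1) i j) (δ i j * diagCoeff ν n i) := by
  induction n with
  | zero =>
    intro i j hij
    rw [P_one_apply]
    rcases hij.eq_or_lt with rfl | hlt
    · rw [δ_self, one_mul]
      exact hv.weight i
    · rw [δ_ne hlt.ne, zero_mul]
      exact hv.raising i j hlt
  | succ n ih =>
    intro i j hij
    rw [P_succ_apply, diagCoeff, Finset.mul_sum]
    refine Acts.sum _ fun k _ => ?_
    rcases lt_trichotomy k j with hk | rfl | hk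
    · have : δ i j * (if k < i then 0 else if k = i then diagCoeff ν n i * ν i
          else diagCoeff ν n i - diagCoeff ν n k) = 0 := by
        by_cases h : i = j
        · rw [h, if_pos hk, mul_zero]
        · rw [δ_ne h, zero_mul]
      rw [this]
      exact (hv.raising k j hk).mul_zero _
    · have : δ i k * (if k < i then 0 else if k = i then diagCoeff ν n i * ν i
          else diagCoeff ν n i - diagCoeff ν n k) = δ i k * diagCoeff ν n i * ν k := by
        by_cases h : i = k
        · rw [h, if_neg (lt_irrefl k), if_pos rfl, mul_assoc]
        · rw [δ_ne h, zero_mul, zero_mul, zero_mul]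
      rw [this]
      exact (ih i k hij).mul (hv.weight k)
    · have hik : i < k := hij.trans_lt hk
      rw [if_neg hik.not_gt, if_neg hik.ne']
      have hcomm : P (n + 1) i k * E k j =
          E k j * P (n + 1) i k - (δ i j • P (n + 1) k k - P (n + 1) i j) := by
        have := covariant₂_P n k j i k
        rw [ad_apply, δ_self, one_smul, show δ j i = δ i j by simp only [δ, eq_comm]] at this
        rw [← this, sub_sub_cancel]
      have h₁ := ih i k hik.le
      rw [δ_ne hik.ne, zero_mul] at h₁
      have h₂ := ih k k le_rfl
      rw [δ_self, one_mul] at h₂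
      rw [hcomm]
      convert (h₁.mul_zero (E k j)).sub ((h₂.smul (δ i j)).sub (ih i j hij)) using 1
      ring

theorem IsHighest.acts_P_self (hv : IsHighest ν v) (n : ℕ) (i : Fin 6) :
    Acts v (P (n + 1) i i) (diagCoeff ν n i) := by
  have := hv.acts_P n i i le_rfl
  rwa [δ_self, one_mul] at this

theorem IsHighest.acts_P_of_lt (hv : IsHighest ν v) (n : ℕ) {i j : Fin 6} (hij : i < j) :
    Acts v (P (n + 1) i j) 0 := by
  have := hv.acts_P n i j hij.le
  rwa [δ_ne hij.ne, zero_mul] at this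

/-- The scalar for the diagonal minors of the matrix of matrix units and its power `n + 1`. -/
def minorCoeff (ν : Fin 6 → ℂ) (n : ℕ) (a b : Fin 6) : ℂ :=
  ν a * diagCoeff ν n b + ν b * diagCoeff ν n a - (diagCoeff ν n a - diagCoeff ν n b)

/-- The scalar for the diagonal minors of the square of the matrix of matrix units. -/
def squareMinorCoeff (ν : Fin 6 → ℂ) (a b : Fin 6) : ℂ :=
  2 * diagCoeff ν 1 a * diagCoeff ν 1 b - (diagCoeff ν 2 a - diagCoeff ν 2 b
    - ν a * diagCoeff ν 1 b + diagCoeff ν 1 a * ν b)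

/-- Of the two off-diagonal products, one already ends in an entry above the diagonal. The other is
reordered so that it does, which adds the commutator of `E a b` and `P (n + 1) b a`. -/
theorem IsHighest.acts_alt_P_one (hv : IsHighest ν v) (n : ℕ) {a b : Fin 6} (hab : a < b) :
    Acts v (alt (P 1) (P (n + 1)) a b a b) (minorCoeff ν n a b) := by
  have hcomm : E a b * P (n + 1) b a =
      P (n + 1) b a * E a b + (P (n + 1) a a - P (n + 1) b b) := by
    have := covariant₂_P n a b b a
    rw [ad_apply, δ_self, δ_self, one_smul, one_smul] at this
    rw [← this, add_sub_cancel]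
  simp only [alt, P_one_apply]
  rw [hcomm]
  convert ((((hv.weight a).mul (hv.acts_P_self n b)).sub
    ((hv.acts_P_of_lt n hab).mul_zero (E b a))).sub
    (((hv.raising a b hab).mul_zero (P (n + 1) b a)).add
    ((hv.acts_P_self n a).sub (hv.acts_P_self n b)))).add
    ((hv.weight b).mul (hv.acts_P_self n a)) using 1
  rw [minorCoeff]
  ring

/-- The commutator of two opposite entries of the square, needed to move the annihilating entry `P 2
a b` to the right. It follows by applying the Leibniz rule to `P 2 a b = ∑ k, E a k * E k b`. -/
theorem P_two_mul_P_two (a b : Fin 6) : P 2 a b * P 2 b a =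
    P 2 b a * P 2 a b + (P 3 a a - E a a * P 2 b b + P 2 a a * E b b - P 3 b b) := by
  -- The cube is split off on the left here and on the right for `P 3 b b`, as the two halves of the
  -- commutator require.
  have hP₃ : P 3 a a = ∑ k, E a k * P 2 k a := by
    rw [P, pow_succ', Matrix.mul_apply]
    rfl
  have hterm : ∀ k, E a k * E k b * P 2 b a - P 2 b a * (E a k * E k b) =
      (E a k * P 2 k a - δ k a • (E a k * P 2 b b)) +
        (δ k b • (P 2 a a * E k b) - P 2 b k * E k b) := by
    intro k
    have h₁ := covariant₂_P 1 k b b a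
    have h₂ := covariant₂_P 1 a k b a
    rw [ad_apply, δ_self, one_smul, sub_eq_iff_eq_add] at h₁ h₂
    rw [mul_assoc, h₁, mul_add, ← mul_assoc (E a k), h₂]
    simp only [add_mul, sub_mul, mul_sub, smul_mul_assoc, mul_smul_comm, mul_assoc]
    abel
  rw [← sub_eq_iff_eq_add']
  conv_lhs => rw [P_succ_apply 1 a b]
  simp only [P_one_apply, Finset.sum_mul, Finset.mul_sum]
  rw [← Finset.sum_sub_distrib]
  simp only [hterm, Finset.sum_add_distrib, Finset.sum_sub_distrib, sum_δ_smul']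
  rw [hP₃, P_succ_apply 2 b b]
  abel

theorem IsHighest.acts_alt_P_two (hv : IsHighest ν v) {a b : Fin 6} (hab : a < b) :
    Acts v (alt (P 2) (P 2) a b a b) (squareMinorCoeff ν a b) := by
  simp only [alt]
  rw [P_two_mul_P_two a b]
  convert ((((hv.acts_P_self 1 a).mul (hv.acts_P_self 1 b)).sub
    ((hv.acts_P_of_lt 1 hab).mul_zero (P 2 b a))).sub
    (((hv.acts_P_of_lt 1 hab).mul_zero (P 2 b a)).add
    ((((hv.acts_P_self 2 a).sub ((hv.weight a).mul (hv.acts_P_self 1 b))).add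
    ((hv.acts_P_self 1 a).mul (hv.weight b))).sub (hv.acts_P_self 2 b)))).add
    ((hv.acts_P_self 1 b).mul (hv.acts_P_self 1 a)) using 1
  rw [squareMinorCoeff]
  ring

/-- The scalar as which `T_{a,b,a,b}` acts on a highest weight vector, for `a < b`. -/
def diagT (ν : Fin 6 → ℂ) (a b : Fin 6) : ℂ :=
  245 / 12 * minorCoeff ν 0 a b - 14 * minorCoeff ν 1 a b + 4 / 3 * minorCoeff ν 2 a b
    + squareMinorCoeff ν a b - 4 / 15 * ((∑ i, diagCoeff ν 1 i) * minorCoeff ν 0 a b)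

theorem IsHighest.acts_T (hv : IsHighest ν v) {a b : Fin 6} (hab : a < b) :
    Acts v (T a b a b) (diagT ν a b) :=
  (((((hv.acts_alt_P_one 0 hab).smul _).sub ((hv.acts_alt_P_one 1 hab).smul _)).add
    ((hv.acts_alt_P_one 2 hab).smul _)).add (hv.acts_alt_P_two hab)).sub
    (((Acts.sum _ fun i _ => hv.acts_P_self 1 i).mul (hv.acts_alt_P_one 0 hab)).smul _)

end Highest

/-! ### Highest weight modules -/

/-- A derivation applied to a determinant. -/
theorem derivation_det {S : Type*} [CommRing S] [Algebra ℂ S] (D : Derivation ℂ S S) {n : Type*}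
    [Fintype n] [DecidableEq n] (A : Matrix n n S) :
    D A.det = ∑ r, (A.updateRow r fun c => D (A r c)).det := by
  have hprod : ∀ (s : Finset n) (x : n → S),
      D (∏ r ∈ s, x r) = ∑ r ∈ s, ∏ k ∈ s, if k = r then D (x k) else x k := by
    intro s x
    induction s using Finset.induction_on with
    | empty => simp
    | insert a s ha ih =>
      rw [Finset.prod_insert ha, Derivation.leibniz, ih, Finset.sum_insert ha,
        Finset.prod_insert ha, if_pos rfl, smul_eq_mul, smul_eq_mul, Finset.mul_sum, add_comm]
      congr 1
      · rw [mul_comm]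
        congr 1
        refine Finset.prod_congr rfl fun k hk => ?_
        rw [if_neg (ne_of_mem_of_not_mem hk ha)]
      · refine Finset.sum_congr rfl fun r hr => ?_
        rw [Finset.prod_insert ha, if_neg (ne_of_mem_of_not_mem hr ha).symm]
  simp only [Matrix.det_apply', map_sum]
  rw [Finset.sum_comm]
  refine Finset.sum_congr rfl fun σ _ => ?_
  have hs : ((Equiv.Perm.sign σ : ℤ) : S) = algebraMap ℂ S ((Equiv.Perm.sign σ : ℤ) : ℂ) := by
    simp
  rw [Derivation.leibniz, hs, Derivation.map_algebraMap, smul_zero, add_zero, smul_eq_mul,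
    hprod, Finset.mul_sum]
  -- The determinant is expanded with factors `A (σ k) k`, so differentiating the factor in column
  -- `r` affects row `σ r`.
  refine Fintype.sum_equiv σ _ _ fun r => ?_
  congr 1
  refine Finset.prod_congr rfl fun k _ => ?_
  rw [Matrix.updateRow_apply]
  by_cases hk : k = r
  · rw [hk, if_pos rfl, if_pos rfl]
  · rw [if_neg hk, if_neg (fun h => hk (σ.injective h))]

/-- The polynomial functions on `6 × 6` matrices. -/
abbrev PolyMat : Type := MvPolynomial (Fin 6 × Fin 6) ℂ

/-- The action of a matrix on the polynomial functions by a derivation. -/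
def derivationOf (A : Matrix (Fin 6) (Fin 6) ℂ) : Derivation ℂ PolyMat PolyMat :=
  mkDerivation ℂ fun p => ∑ j, C (A j p.1) * X (j, p.2)

theorem derivationOf_X (A : Matrix (Fin 6) (Fin 6) ℂ) (i k : Fin 6) :
    derivationOf A (X (i, k)) = ∑ j, C (A j i) * X (j, k) := mkDerivation_X _ _ _

theorem derivationOf_derivationOf_X (A B : Matrix (Fin 6) (Fin 6) ℂ) (i k : Fin 6) :
    derivationOf A (derivationOf B (X (i, k))) = ∑ l, C ((A * B) l i) * X (l, k) := by
  have hterm : ∀ j, derivationOf A (C (B j i) * X (j, k)) =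
      ∑ l, C (A l j * B j i) * X (l, k) := by
    intro j
    rw [← smul_eq_C_mul, Derivation.map_smul, derivationOf_X, Finset.smul_sum]
    refine Finset.sum_congr rfl fun l _ => ?_
    rw [smul_eq_C_mul, ← mul_assoc, ← C_mul, mul_comm (B j i)]
  rw [derivationOf_X, map_sum, Finset.sum_congr rfl fun j _ => hterm j, Finset.sum_comm]
  refine Finset.sum_congr rfl fun l _ => ?_
  rw [Matrix.mul_apply, map_sum, Finset.sum_mul]

/-- The action of `𝔰𝔩₆` on the polynomial functions. -/
def polyRep : g →ₗ⁅ℂ⁆ Module.End ℂ PolyMat where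
  toFun A := (derivationOf A : PolyMat →ₗ[ℂ] PolyMat)
  map_add' A B := by
    have : derivationOf ((A + B : g) : Matrix (Fin 6) (Fin 6) ℂ) =
        derivationOf A + derivationOf B := by
      refine derivation_ext fun ⟨i, k⟩ => ?_
      rw [Derivation.add_apply]
      simp only [derivationOf_X]
      rw [← Finset.sum_add_distrib]
      refine Finset.sum_congr rfl fun j _ => ?_
      rw [← add_mul, ← C_add]
      rfl
    rw [this]
    rfl
  map_smul' t A := by
    have : derivationOf ((t • A : g) : Matrix (Fin 6) (Fin 6) ℂ) = t • derivationOf A := by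
      refine derivation_ext fun ⟨i, k⟩ => ?_
      rw [Derivation.smul_apply]
      simp only [derivationOf_X]
      rw [Finset.smul_sum]
      refine Finset.sum_congr rfl fun j _ => ?_
      rw [smul_eq_C_mul, ← mul_assoc, ← C_mul]
      rfl
    rw [this]
    rfl
  map_lie' {A B} := by
    have : derivationOf ((⁅A, B⁆ : g) : Matrix (Fin 6) (Fin 6) ℂ) =
        ⁅derivationOf A, derivationOf B⁆ := by
      refine derivation_ext fun ⟨i, k⟩ => ?_
      rw [Derivation.commutator_apply, derivationOf_derivationOf_X, derivationOf_derivationOf_X,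
        derivationOf_X, ← Finset.sum_sub_distrib, LieAlgebra.SpecialLinear.sl_bracket]
      refine Finset.sum_congr rfl fun j _ => ?_
      rw [Matrix.sub_apply, C_sub, sub_mul]
    rw [this, Derivation.commutator_coe_linear_map]

theorem polyRep_apply (A : g) (q : PolyMat) : polyRep A q = derivationOf A q := rfl

/-- The leading principal minor of size `k`. -/
def leadingMinor (k : ℕ) (hk : k ≤ 6) : PolyMat :=
  (Matrix.of fun r c : Fin k => (X (Fin.castLE hk r, Fin.castLE hk c) : PolyMat)).det

theorem leadingMinor_ne_zero (k : ℕ) (hk : k ≤ 6) : leadingMinor k hk ≠ 0 := by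
  intro h0
  have := congrArg (eval fun p : Fin 6 × Fin 6 => if p.1 = p.2 then (1 : ℂ) else 0) h0
  rw [leadingMinor, RingHom.map_det, map_zero] at this
  have hone : (eval fun p : Fin 6 × Fin 6 => if p.1 = p.2 then (1 : ℂ) else 0).mapMatrix
      (Matrix.of fun r c : Fin k => (X (Fin.castLE hk r, Fin.castLE hk c) : PolyMat)) = 1 := by
    ext r c
    simp [Matrix.one_apply]
  rw [hone, Matrix.det_one] at this
  exact one_ne_zero this

/-- An upper triangular `A` replaces row `r` by a combination of the rows up to `r`, all inside the
minor. In the determinant only the multiple of row `r` itself survives. -/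
theorem derivationOf_leadingMinor {A : Matrix (Fin 6) (Fin 6) ℂ}
    (hA : ∀ i j, j < i → A i j = 0) (k : ℕ) (hk : k ≤ 6) :
    derivationOf A (leadingMinor k hk) =
      (∑ r : Fin k, A (Fin.castLE hk r) (Fin.castLE hk r)) • leadingMinor k hk := by
  rw [leadingMinor, derivation_det, Finset.sum_smul]
  refine Finset.sum_congr rfl fun r _ => ?_
  set B : Matrix (Fin k) (Fin k) PolyMat :=
    Matrix.of fun r c : Fin k => (X (Fin.castLE hk r, Fin.castLE hk c) : PolyMat) with hB
  have hrow : (fun c => derivationOf A (B r c)) =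
      ∑ s : Fin k, (C (A (Fin.castLE hk s) (Fin.castLE hk r)) : PolyMat) • B s := by
    funext c
    rw [hB, Matrix.of_apply, derivationOf_X, Finset.sum_apply]
    have himg : ∀ j : Fin 6, j ∉ Finset.univ.map (Fin.castLEEmb hk) →
        C (A j (Fin.castLE hk r)) * X (j, Fin.castLE hk c) = (0 : PolyMat) := by
      intro j hj
      have hlt : Fin.castLE hk r < j := by
        by_contra hle
        refine hj (Finset.mem_map.2 ⟨⟨j.val, ?_⟩, Finset.mem_univ _, rfl⟩)
        have : j.val ≤ r.val := not_lt.1 hle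
        omega
      rw [hA j _ hlt, C_0, zero_mul]
    rw [← Finset.sum_subset (Finset.subset_univ (Finset.univ.map (Fin.castLEEmb hk)))
      fun j _ hj => himg j hj, Finset.sum_map]
    rfl
  rw [hrow, Matrix.det_updateRow_sum, smul_eq_C_mul]
  rfl

/-- Semi-invariance under a derivation. -/
theorem derivation_mul_eq {S : Type*} [CommRing S] [Algebra ℂ S] (D : Derivation ℂ S S) {x y : S}
    {s t : ℂ} (hx : D x = s • x) (hy : D y = t • y) : D (x * y) = (s + t) • (x * y) := by
  rw [Derivation.leibniz, hx, hy, smul_eq_mul, smul_eq_mul, add_smul, mul_smul_comm,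
    mul_smul_comm, mul_comm y x, add_comm]

theorem derivation_pow_eq {S : Type*} [CommRing S] [Algebra ℂ S] (D : Derivation ℂ S S) {x : S}
    {s : ℂ} (hx : D x = s • x) (n : ℕ) : D (x ^ n) = ((n : ℂ) * s) • x ^ n := by
  induction n with
  | zero => simp
  | succ n ih =>
    rw [pow_succ, derivation_mul_eq D ih hx]
    congr 1
    push_cast
    ring

theorem derivation_prod_eq {S : Type*} [CommRing S] [Algebra ℂ S] (D : Derivation ℂ S S)
    {κ : Type*} (u : Finset κ) {x : κ → S} {s : κ → ℂ} (hx : ∀ k, D (x k) = s k • x k) :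
    D (∏ k ∈ u, x k) = (∑ k ∈ u, s k) • ∏ k ∈ u, x k := by
  classical
  induction u using Finset.induction_on with
  | empty => simp
  | insert a u ha ih =>
    rw [Finset.prod_insert ha, Finset.sum_insert ha, derivation_mul_eq D (hx a) ih]

/-- The product of powers of leading principal minors. -/
def minorProd (n : Fin 5 → ℕ) : PolyMat :=
  ∏ k : Fin 5, leadingMinor (k.val + 1) (by omega) ^ n k

theorem minorProd_ne_zero (n : Fin 5 → ℕ) : minorProd n ≠ 0 :=
  Finset.prod_ne_zero_iff.2 fun _ _ => pow_ne_zero _ (leadingMinor_ne_zero _ _)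

/-- The dominant integral weight with coordinates `n_k`, on upper triangular matrices. -/
def dominantWeight (n : Fin 5 → ℕ) (A : Matrix (Fin 6) (Fin 6) ℂ) : ℂ :=
  ∑ k : Fin 5, (n k : ℂ) * ∑ r : Fin (k.val + 1),
    A (Fin.castLE (by omega) r) (Fin.castLE (by omega) r)

theorem derivationOf_minorProd {A : Matrix (Fin 6) (Fin 6) ℂ} (hA : ∀ i j, j < i → A i j = 0)
    (n : Fin 5 → ℕ) : derivationOf A (minorProd n) = dominantWeight n A • minorProd n :=
  derivation_prod_eq _ _ fun _ => derivation_pow_eq _ (derivationOf_leadingMinor hA _ _) _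

/-- The dominant integral weight with coordinates `n_k`. -/
def dominant (n : Fin 5 → ℕ) : Module.Dual ℂ cartan where
  toFun H := dominantWeight n (H : g)
  map_add' H K := by
    simp only [dominantWeight, ← Finset.sum_add_distrib, ← mul_add]
    rfl
  map_smul' t H := by
    simp only [dominantWeight, smul_eq_mul, Finset.mul_sum, RingHom.id_apply]
    refine Finset.sum_congr rfl fun k _ => Finset.sum_congr rfl fun r _ => ?_
    rw [mul_left_comm]
    rfl

theorem dominantWeight_eq (n : Fin 5 → ℕ) (A : Matrix (Fin 6) (Fin 6) ℂ) :
    dominantWeight n A = n 0 * A 0 0 + n 1 * (A 0 0 + A 1 1) + n 2 * (A 0 0 + A 1 1 + A 2 2)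
      + n 3 * (A 0 0 + A 1 1 + A 2 2 + A 3 3)
      + n 4 * (A 0 0 + A 1 1 + A 2 2 + A 3 3 + A 4 4) := by
  have s₀ : ∑ r : Fin ((0 : Fin 5).val + 1),
    A (Fin.castLE (by decide) r) (Fin.castLE (by decide) r) = A 0 0 := Fin.sum_univ_one _
  have s₁ : ∑ r : Fin ((1 : Fin 5).val + 1), A (Fin.castLE (by decide) r)
    (Fin.castLE (by decide) r) = A 0 0 + A 1 1 := Fin.sum_univ_two _
  have s₂ : ∑ r : Fin ((2 : Fin 5).val + 1), A (Fin.castLE (by decide) r)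
    (Fin.castLE (by decide) r) = A 0 0 + A 1 1 + A 2 2 := Fin.sum_univ_three _
  have s₃ : ∑ r : Fin ((3 : Fin 5).val + 1), A (Fin.castLE (by decide) r)
    (Fin.castLE (by decide) r) = A 0 0 + A 1 1 + A 2 2 + A 3 3 := Fin.sum_univ_four _
  have s₄ : ∑ r : Fin ((4 : Fin 5).val + 1), A (Fin.castLE (by decide) r)
    (Fin.castLE (by decide) r) = A 0 0 + A 1 1 + A 2 2 + A 3 3 + A 4 4 := Fin.sum_univ_five _
  rw [dominantWeight, Fin.sum_univ_five, s₀, s₁, s₂, s₃, s₄]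

theorem dominant_coroot (n : Fin 5 → ℕ) (i : Fin 5) :
    dominant n ⟨coroot (i.val + 1), coroot_mem_cartan (i.val + 1)⟩ = n i := by
  change dominantWeight n (coroot (i.val + 1) : Matrix (Fin 6) (Fin 6) ℂ) = n i
  rw [coroot, LieAlgebra.SpecialLinear.val_singleSubSingle, dominantWeight_eq]
  fin_cases i <;> simp [ix, Fin.ext_iff, Fin.ofNat]

/-- Every dominant integral weight is the highest weight of an irreducible module. -/
theorem exists_isIrreducibleHighestWeight (n : Fin 5 → ℕ) :
    ∃ (M : Type) (_ : AddCommGroup M) (_ : Module U M) (v : M),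
      IsIrreducibleHighestWeight (dominant n) M v := by
  let Φ : U →ₐ[ℂ] Module.End ℂ PolyMat := UniversalEnvelopingAlgebra.lift ℂ polyRep
  have hΦ : ∀ A : g, Φ (inc A) = polyRep A := fun A =>
    UniversalEnvelopingAlgebra.lift_ι_apply ℂ polyRep A
  -- The annihilator of `minorProd n` is a proper left ideal. The quotient of `U` by a maximal left
  -- ideal above it is simple, and the class of 1 inherits the highest weight relations.
  let I : Submodule U U :=
    { carrier := {u | Φ u (minorProd n) = 0}
      add_mem' := fun {u w} hu hw => by
        rw [Set.mem_ofPred_eq] at hu hw ⊢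
        rw [map_add, LinearMap.add_apply, hu, hw, add_zero]
      zero_mem' := by rw [Set.mem_ofPred_eq, map_zero, LinearMap.zero_apply]
      smul_mem' := fun u w hw => by
        rw [Set.mem_ofPred_eq] at hw ⊢
        rw [smul_eq_mul, map_mul, Module.End.mul_apply, hw, map_zero] }
  have hI : ∀ u, u ∈ I ↔ Φ u (minorProd n) = 0 := fun _ => Iff.rfl
  have hne : I ≠ ⊤ := by
    intro h
    have h1 : (1 : U) ∈ I := h ▸ Submodule.mem_top
    rw [hI, map_one, Module.End.one_apply] at h1
    exact minorProd_ne_zero n h1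
  obtain ⟨J, hJ, hIJ⟩ := Ideal.exists_le_maximal I hne
  refine ⟨U ⧸ J, inferInstance, inferInstance, Submodule.Quotient.mk 1, ?_, ?_, ?_, ?_⟩
  · exact isSimpleModule_iff_isCoatom.2 hJ.out
  · rw [Ne, Submodule.Quotient.mk_eq_zero]
    intro h1
    exact hJ.ne_top ((Ideal.eq_top_iff_one J).2 h1)
  · intro A hA
    rw [← Submodule.Quotient.mk_smul, Submodule.Quotient.mk_eq_zero, smul_eq_mul, mul_one]
    apply hIJ
    rw [hI, hΦ, polyRep_apply, derivationOf_minorProd fun i j hji => hA i j hji.le]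
    have h0 : dominantWeight n A = 0 :=
      Finset.sum_eq_zero fun _ _ => by
        rw [Finset.sum_eq_zero fun r _ => hA _ _ le_rfl, mul_zero]
    rw [h0, zero_smul]
  · intro H
    rw [← Submodule.Quotient.mk_smul, ← Submodule.Quotient.mk_smul, Submodule.Quotient.eq,
      smul_eq_mul, smul_eq_mul, mul_one, mul_one]
    apply hIJ
    rw [hI, map_sub, hΦ, AlgHom.commutes, LinearMap.sub_apply, polyRep_apply,
      derivationOf_minorProd fun i j hji => H.2 hji.ne', Module.algebraMap_end_apply]
    exact sub_self _

theorem IsIrreducibleHighestWeight.smul_left_injective {μ : Module.Dual ℂ cartan} {M : Type}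
    [AddCommGroup M] [Module U M] {v : M} (hv : IsIrreducibleHighestWeight μ M v) {s t : ℂ}
    (hst : algebraMap ℂ U s • v = algebraMap ℂ U t • v) : s = t := by
  by_contra hne
  apply hv.ne_zero
  have h0 : algebraMap ℂ U (s - t) • v = 0 := by rw [map_sub, sub_smul, hst, sub_self]
  have h1 : algebraMap ℂ U ((s - t)⁻¹ * (s - t)) • v = 0 := by
    rw [map_mul, mul_smul, h0, smul_zero]
  rwa [inv_mul_cancel₀ (sub_ne_zero.2 hne), map_one, one_smul] at h1

/-- The polynomial `p_r` is unique. -/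
theorem IsPolyOf.unique {r : U} {q q' : MvPolynomial (Fin 5) ℂ} (hq : IsPolyOf r q)
    (hq' : IsPolyOf r q') : q = q' := by
  -- Two polynomials that agree on `ℕ⁵` are equal, so dominant integral weights suffice.
  refine MvPolynomial.funext_set (fun _ : Fin 5 => Set.range ((↑) : ℕ → ℂ))
    (fun _ => Set.infinite_range_of_injective Nat.cast_injective) fun x hx => ?_
  choose n hn using fun i => hx i (Set.mem_univ i)
  obtain ⟨M, _, _, v, hv⟩ := exists_isIrreducibleHighestWeight n
  have := hv.smul_left_injective ((hq _ M v hv).symm.trans (hq' _ M v hv))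
  have hpt : (fun i : Fin 5 => dominant n ⟨coroot (i.val + 1), coroot_mem_cartan (i.val + 1)⟩) =
      x := funext fun i => (dominant_coroot n i).trans (hn i)
  rwa [evalAt, evalAt, hpt] at this

/-! ### Evaluation of the polynomials -/

/-- The values of the simple coroots for given values of the `E_{i,i}`. -/
def corootValues (ν : Fin 6 → ℂ) (i : Fin 5) : ℂ := ν i.castSucc - ν i.succ

/-- The summand 5, 4, …, 0 next to the weight counts the indices `k > i`, each of which contributes
`diagCoeff ν n i` once. -/
theorem diagCoeff_succ (ν : Fin 6 → ℂ) (n : ℕ) :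
    diagCoeff ν (n + 1) = ![(ν 0 + 5) * diagCoeff ν n 0 - (diagCoeff ν n 1 + diagCoeff ν n 2
        + diagCoeff ν n 3 + diagCoeff ν n 4 + diagCoeff ν n 5),
      (ν 1 + 4) * diagCoeff ν n 1 - (diagCoeff ν n 2 + diagCoeff ν n 3 + diagCoeff ν n 4
        + diagCoeff ν n 5),
      (ν 2 + 3) * diagCoeff ν n 2 - (diagCoeff ν n 3 + diagCoeff ν n 4 + diagCoeff ν n 5),
      (ν 3 + 2) * diagCoeff ν n 3 - (diagCoeff ν n 4 + diagCoeff ν n 5),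
      (ν 4 + 1) * diagCoeff ν n 4 - diagCoeff ν n 5,
      ν 5 * diagCoeff ν n 5] := by
  funext i
  rw [diagCoeff, Fin.sum_univ_six]
  fin_cases i <;> simp <;> ring

/-- The scalar for the combination of the `T_{a,b,a,b}` attached to a `4`-cycle. -/
def cycleCoeff (ν : Fin 6 → ℂ) (a b c d : Fin 6) : ℂ :=
  diagT ν a b - diagT ν (min b c) (max b c) - diagT ν a d + diagT ν (min c d) (max c d)

/-- The `4`-cycles attached to the polynomials `p_1, …, p_9`. -/
def cycleIndex : Fin 9 → Fin 4 → Fin 6 :=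
  ![![0, 2, 1, 3], ![0, 3, 1, 4], ![0, 4, 1, 5], ![1, 3, 2, 4], ![1, 4, 2, 5], ![2, 4, 3, 5],
    ![0, 1, 5, 2], ![0, 2, 5, 3], ![0, 3, 5, 4]]

/-- The scaling factors attached to the polynomials `p_1, …, p_9`. -/
def cycleScale : Fin 9 → ℂ := ![30, -30, -30, -30, -30, 30, 15, -15, 15]

/-- The scalar for the `4`-cycle attached to `p_{i+1}`. -/
def cycleValue (ν : Fin 6 → ℂ) (i : Fin 9) : ℂ :=
  cycleCoeff ν (cycleIndex i 0) (cycleIndex i 1) (cycleIndex i 2) (cycleIndex i 3)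

theorem cycleValue_eq (ν : Fin 6 → ℂ) :
    cycleValue ν = ![diagT ν 0 2 - diagT ν 1 2 - diagT ν 0 3 + diagT ν 1 3,
      diagT ν 0 3 - diagT ν 1 3 - diagT ν 0 4 + diagT ν 1 4,
      diagT ν 0 4 - diagT ν 1 4 - diagT ν 0 5 + diagT ν 1 5,
      diagT ν 1 3 - diagT ν 2 3 - diagT ν 1 4 + diagT ν 2 4,
      diagT ν 1 4 - diagT ν 2 4 - diagT ν 1 5 + diagT ν 2 5,
      diagT ν 2 4 - diagT ν 3 4 - diagT ν 2 5 + diagT ν 3 5,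
      diagT ν 0 1 - diagT ν 1 5 - diagT ν 0 2 + diagT ν 2 5,
      diagT ν 0 2 - diagT ν 2 5 - diagT ν 0 3 + diagT ν 3 5,
      diagT ν 0 3 - diagT ν 3 5 - diagT ν 0 4 + diagT ν 4 5] := by
  funext i
  fin_cases i <;> rfl

-- The values of the coroots determine `ν` only up to a common shift, which the condition of sum
-- zero removes; eliminating `ν 5` leaves a polynomial identity in five variables.
set_option maxHeartbeats 2000000 in
theorem eval_p {ν : Fin 6 → ℂ} (hν : ∑ i, ν i = 0) (i : Fin 9) :
    eval (corootValues ν) (p i) = cycleScale i * cycleValue ν i := by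
  have h5 : ν 5 = -(ν 0 + ν 1 + ν 2 + ν 3 + ν 4) := by
    rw [Fin.sum_univ_six] at hν
    linear_combination hν
  rw [cycleValue_eq]
  fin_cases i <;>
  · simp [p, cycleScale]
    simp only [diagT, minorCoeff, squareMinorCoeff, Fin.sum_univ_six, diagCoeff_succ]
    simp [p1, p2, p3, p4, p5, p6, p7, p8, p9, corootValues, diagCoeff]
    rw [h5]
    ring

/-! ### The polynomials of zero weight vectors -/

theorem IsHighest.acts_T_of_ne {M : Type*} [AddCommGroup M] [Module U M] {v : M}
    {ν : Fin 6 → ℂ} (hv : IsHighest ν v) {a b : Fin 6} (hab : a ≠ b) :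
    Acts v (T a b a b) (diagT ν (min a b) (max a b)) := by
  rcases hab.lt_or_gt with h | h
  · rw [min_eq_left h.le, max_eq_right h.le]
    exact hv.acts_T h
  · rw [min_eq_right h.le, max_eq_left h.le, ← T_swap_both]
    exact hv.acts_T h

theorem IsHighest.acts_cycle {M : Type*} [AddCommGroup M] [Module U M] {v : M} {ν : Fin 6 → ℂ}
    (hv : IsHighest ν v) {a b c d : Fin 6} (hab : a < b) (had : a < d) (hbc : b ≠ c)
    (hcd : c ≠ d) : Acts v (cycle a b c d) (cycleCoeff ν a b c d) := by
  rw [cycle, ← T_swap_both c b]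
  exact (((hv.acts_T hab).sub (hv.acts_T_of_ne hbc)).sub (hv.acts_T had)).add
    (hv.acts_T_of_ne hcd)

/-- The weight `ν i` is the value of `μ` at the traceless part of `E_{i,i}`. -/
theorem IsIrreducibleHighestWeight.exists_isHighest {μ : Module.Dual ℂ cartan} {M : Type}
    [AddCommGroup M] [Module U M] {v : M} (hv : IsIrreducibleHighestWeight μ M v) :
    ∃ ν : Fin 6 → ℂ, IsHighest ν v ∧ ∑ i, ν i = 0 ∧
      ∀ q, evalAt μ q = eval (corootValues ν) q := by
  let H : Fin 6 → cartan := fun i => ⟨traceless (Matrix.single i i 1), traceless_single_mem i⟩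
  refine ⟨fun i => μ (H i), ⟨fun i j hij => ?_, fun i => hv.weight (H i)⟩, ?_, fun q => ?_⟩
  · rw [Acts, map_zero, zero_smul, ← single_eq_E hij.ne]
    refine hv.raising _ fun a b hba => ?_
    rw [LieAlgebra.SpecialLinear.val_single, Matrix.single_apply_of_ne]
    rintro ⟨rfl, rfl⟩
    exact absurd hij hba.not_gt
  · have hH : ∑ i, H i = 0 := by
      apply Subtype.ext
      rw [AddSubmonoidClass.coe_finsetSum]
      change ∑ i, traceless (Matrix.single i i 1) = 0
      rw [← map_sum, Matrix.sum_single_one, traceless_one]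
    rw [← map_sum, hH, map_zero]
  · rw [evalAt]
    congr 2
    funext i
    rw [corootValues, ← map_sub]
    congr 1
    apply Subtype.ext
    change coroot (i.val + 1) = traceless (Matrix.single i.castSucc i.castSucc 1) -
      traceless (Matrix.single i.succ i.succ 1)
    rw [← map_sub, ← traceless_coe (coroot (i.val + 1)), coroot,
      LieAlgebra.SpecialLinear.val_singleSubSingle]
    fin_cases i <;> rfl

/-- From `T 0 1 4 5` every required entry is reached by changing one index at a time, with upper and
lower indices kept disjoint throughout. -/
theorem cycleIndex_T_mem_R (i : Fin 9) :
    T (cycleIndex i 0) (cycleIndex i 1) (cycleIndex i 2) (cycleIndex i 3) ∈ R := by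
  have t₀ : T 0 1 4 5 ∈ R := by
    rw [R, Submodule.mem_sInf, ← v'_eq_T]
    exact fun N hN => hN.1
  have t₂ : T 0 2 4 5 ∈ R := T_mem_R_of_snd t₀ 2 (by decide) (by decide) (by decide)
  have t₃ : T 0 3 4 5 ∈ R := T_mem_R_of_snd t₀ 3 (by decide) (by decide) (by decide)
  have u₂ : T 0 2 1 5 ∈ R := T_mem_R_of_trd t₂ 1 (by decide) (by decide) (by decide)
  have u₃ : T 0 3 1 5 ∈ R := T_mem_R_of_trd t₃ 1 (by decide) (by decide) (by decide)
  have u₄ : T 0 4 1 5 ∈ R := T_mem_R_of_snd u₃ 4 (by decide) (by decide) (by decide)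
  have w₁ : T 1 3 4 5 ∈ R := T_mem_R_of_fst t₃ 1 (by decide) (by decide) (by decide)
  have w₂ : T 1 3 2 5 ∈ R := T_mem_R_of_trd w₁ 2 (by decide) (by decide) (by decide)
  have w₃ : T 0 4 3 5 ∈ R := T_mem_R_of_trd u₄ 3 (by decide) (by decide) (by decide)
  have w₄ : T 0 1 4 2 ∈ R := T_mem_R_of_fth t₀ 2 (by decide) (by decide) (by decide)
  have w₅ : T 0 2 4 3 ∈ R := T_mem_R_of_fth t₂ 3 (by decide) (by decide) (by decide)
  have w₆ : T 0 3 2 5 ∈ R := T_mem_R_of_trd t₃ 2 (by decide) (by decide) (by decide)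
  have w₇ : T 0 3 2 4 ∈ R := T_mem_R_of_fth w₆ 4 (by decide) (by decide) (by decide)
  fin_cases i
  · exact T_mem_R_of_fth u₂ 3 (by decide) (by decide) (by decide)
  · exact T_mem_R_of_fth u₃ 4 (by decide) (by decide) (by decide)
  · exact u₄
  · exact T_mem_R_of_fth w₂ 4 (by decide) (by decide) (by decide)
  · exact T_mem_R_of_snd w₂ 4 (by decide) (by decide) (by decide)
  · exact T_mem_R_of_fst w₃ 2 (by decide) (by decide) (by decide)
  · exact T_mem_R_of_trd w₄ 5 (by decide) (by decide) (by decide)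
  · exact T_mem_R_of_trd w₅ 5 (by decide) (by decide) (by decide)
  · exact T_mem_R_of_trd w₇ 5 (by decide) (by decide) (by decide)

theorem cycleIndex_ne : ∀ i, cycleIndex i 0 < cycleIndex i 1 ∧ cycleIndex i 0 < cycleIndex i 3 ∧
    cycleIndex i 1 ≠ cycleIndex i 2 ∧ cycleIndex i 2 ≠ cycleIndex i 3 := by
  decide

theorem p_mem_P0 (i : Fin 9) : p i ∈ P0 := by
  obtain ⟨hab, had, hbc, hcd⟩ := cycleIndex_ne i
  refine ⟨cycleScale i • cycle (cycleIndex i 0) (cycleIndex i 1) (cycleIndex i 2) (cycleIndex i 3),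
    R0.smul_mem _ (cycle_mem_R0 (cycleIndex_T_mem_R i) hab.ne had.ne hbc hcd),
    fun μ M _ _ v hv => ?_⟩
  obtain ⟨ν, hw, h0, hq⟩ := hv.exists_isHighest
  rw [hq, eval_p h0]
  exact (hw.acts_cycle hab had hbc hcd).smul _

/-- The nine cycles span the edge weightings with sum zero at each vertex. The coefficients are read
off from edges that lie in few cycles; for example, the edge `{0, 1}` occurs only in the seventh.
The factor 2 accounts for ordered pairs. -/
theorem sum_diagT_eq {y : Fin 6 → Fin 6 → ℂ} (hsymm : ∀ a b, y a b = y b a)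
    (hdiag : ∀ a, y a a = 0) (hrow : ∀ a, ∑ b, y a b = 0) (ν : Fin 6 → ℂ) :
    ∑ a, ∑ b, y a b * diagT ν (min a b) (max a b) =
      ∑ i, 2 * ![-y 1 2, -(y 1 3 + y 1 2 + y 2 3), -y 0 5, -y 2 3, -(y 2 4 + y 2 3 + y 3 4),
        -y 3 4, y 0 1, y 1 2 + y 0 1 + y 0 2, y 4 5] i * cycleValue ν i := by
  have r₀ := hrow 0
  have r₁ := hrow 1
  have r₂ := hrow 2
  have r₃ := hrow 3
  have r₄ := hrow 4
  have r₅ := hrow 5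
  rw [Fin.sum_univ_six, hdiag] at r₀ r₁ r₂ r₃ r₄ r₅
  rw [hsymm 1 0] at r₁
  rw [hsymm 2 0, hsymm 2 1] at r₂
  rw [hsymm 3 0, hsymm 3 1, hsymm 3 2] at r₃
  rw [hsymm 4 0, hsymm 4 1, hsymm 4 2, hsymm 4 3] at r₄
  rw [hsymm 5 0, hsymm 5 1, hsymm 5 2, hsymm 5 3, hsymm 5 4] at r₅
  -- The six edges solved for form the odd cycle 0, 3, 5, 1, 4 with the edge `{2, 5}` attached. The
  -- vertex equations are uniquely solvable on such a graph, with halves because of the odd cycle.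
  have y₀₃ : y 0 3 = -y 1 3 - y 2 3 - y 1 2 - y 0 1 - y 0 2 + y 4 5 := by
    linear_combination (r₀ + r₁ + r₂ + r₃ - r₄ - r₅) / 2
  have y₀₄ : y 0 4 = y 1 3 + y 1 2 + y 2 3 - y 0 5 - y 4 5 := by
    linear_combination (r₀ - r₁ - r₂ - r₃ + r₄ + r₅) / 2
  have y₁₄ : y 1 4 = -y 1 3 - y 1 2 + y 0 5 - y 2 3 - y 2 4 - y 3 4 := by
    linear_combination (-r₀ + r₁ + r₂ + r₃ + r₄ - r₅) / 2
  have y₁₅ : y 1 5 = -y 0 5 + y 2 4 + y 2 3 + y 3 4 - y 0 1 := by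
    linear_combination (r₀ + r₁ - r₂ - r₃ - r₄ + r₅) / 2
  have y₂₅ : y 2 5 = -y 2 4 - y 2 3 - y 1 2 - y 0 2 := by
    linear_combination r₂
  have y₃₅ : y 3 5 = -y 3 4 + y 1 2 + y 0 1 + y 0 2 - y 4 5 := by
    linear_combination (-r₀ - r₁ - r₂ + r₃ + r₄ + r₅) / 2
  have hpair : ∀ F : Fin 6 → Fin 6 → ℂ, ∑ a, ∑ b, y a b * F (min a b) (max a b) =
      2 * (y 0 1 * F 0 1 + y 0 2 * F 0 2 + y 0 3 * F 0 3 + y 0 4 * F 0 4 + y 0 5 * F 0 5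
        + y 1 2 * F 1 2 + y 1 3 * F 1 3 + y 1 4 * F 1 4 + y 1 5 * F 1 5 + y 2 3 * F 2 3
        + y 2 4 * F 2 4 + y 2 5 * F 2 5 + y 3 4 * F 3 4 + y 3 5 * F 3 5 + y 4 5 * F 4 5) := by
    intro F
    simp only [Fin.sum_univ_six, hdiag, hsymm 1 0, hsymm 2 0, hsymm 2 1, hsymm 3 0, hsymm 3 1,
      hsymm 3 2, hsymm 4 0, hsymm 4 1, hsymm 4 2, hsymm 4 3, hsymm 5 0, hsymm 5 1, hsymm 5 2,
      hsymm 5 3, hsymm 5 4]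
    have hF : ∀ a b : Fin 6, a < b → F (min a b) (max a b) = F a b ∧
        F (min b a) (max b a) = F a b := by
      intro a b hab
      rw [min_eq_left hab.le, max_eq_right hab.le, min_eq_right hab.le, max_eq_left hab.le]
      exact ⟨rfl, rfl⟩
    simp only [hF 0 1 (by decide), hF 0 2 (by decide), hF 0 3 (by decide), hF 0 4 (by decide),
      hF 0 5 (by decide), hF 1 2 (by decide), hF 1 3 (by decide), hF 1 4 (by decide),
      hF 1 5 (by decide), hF 2 3 (by decide), hF 2 4 (by decide), hF 2 5 (by decide),
      hF 3 4 (by decide), hF 3 5 (by decide), hF 4 5 (by decide)]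
    ring
  rw [hpair, y₀₃, y₀₄, y₁₄, y₁₅, y₂₅, y₃₅, cycleValue_eq]
  simp only [Fin.sum_univ_castSucc, Finset.univ_eq_empty, Finset.sum_empty]
  simp
  ring

theorem P0_le_span : P0 ≤ Submodule.span ℂ (Set.range p) := by
  rintro q ⟨r, hr, hrq⟩
  obtain ⟨y, hsymm, hdiag, hrow, rfl⟩ := exists_of_mem_R0 hr
  set c : Fin 9 → ℂ := ![-y 1 2, -(y 1 3 + y 1 2 + y 2 3), -y 0 5, -y 2 3,
    -(y 2 4 + y 2 3 + y 3 4), -y 3 4, y 0 1, y 1 2 + y 0 1 + y 0 2, y 4 5] with hc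
  have hscale : ∀ i, cycleScale i ≠ 0 := by
    intro i
    fin_cases i <;> simp [cycleScale]
  have hpoly : IsPolyOf (∑ a, ∑ b, y a b • T a b a b)
      (∑ i, (2 * c i / cycleScale i) • p i) := by
    intro μ M _ _ v hv
    obtain ⟨ν, hw, h0, hq⟩ := hv.exists_isHighest
    have hact : Acts v (∑ a, ∑ b, y a b • T a b a b)
        (∑ a, ∑ b, y a b * diagT ν (min a b) (max a b)) := by
      refine Acts.sum _ fun a _ => Acts.sum _ fun b _ => ?_
      by_cases hab : a = b
      · rw [hab, hdiag, zero_smul, zero_mul]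
        exact acts_zero v
      · exact (hw.acts_T_of_ne hab).smul _
    rw [sum_diagT_eq hsymm hdiag hrow] at hact
    have hsum : eval (corootValues ν) (∑ i, (2 * c i / cycleScale i) • p i) =
        ∑ i, 2 * c i * cycleValue ν i := by
      rw [map_sum]
      refine Finset.sum_congr rfl fun i _ => ?_
      rw [smul_eval, eval_p h0, ← mul_assoc, div_mul_cancel₀ _ (hscale i)]
    rw [hq, hsum]
    exact hact
  rw [hrq.unique hpoly]
  exact Submodule.sum_mem _ fun i _ =>
    Submodule.smul_mem _ _ (Submodule.subset_span (Set.mem_range_self i))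

/-- The system is triangular. At a coordinate vector `p_1, …, p_6` vanish, as each contains a
product of two variables, and the vectors for `h_2`, `h_3`, `h_4` isolate `p_7`, `p_8`, `p_9`. Sums
of two coordinate vectors then isolate the first six. -/
theorem linearIndependent_p : LinearIndependent ℂ p := by
  rw [Fintype.linearIndependent_iff]
  intro c hc
  have hev : ∀ x₁ x₂ x₃ x₄ x₅ : ℂ, ∑ i, c i * eval ![x₁, x₂, x₃, x₄, x₅] (p i) = 0 := by
    intro x₁ x₂ x₃ x₄ x₅
    have := congrArg (eval ![x₁, x₂, x₃, x₄, x₅]) hc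
    rw [map_sum, map_zero] at this
    simpa only [smul_eval] using this
  simp only [Fin.sum_univ_castSucc, Finset.univ_eq_empty, Finset.sum_empty] at hev
  simp [p, p1, p2, p3, p4, p5, p6, p7, p8, p9] at hev
  have c₆ : c 6 = 0 := by
    have := hev 0 1 0 0 0
    norm_num  at this
    exact this
  have c₇ : c 7 = 0 := by
    have := hev 0 0 1 0 0
    norm_num  at this
    exact this
  have c₈ : c 8 = 0 := by
    have := hev 0 0 0 1 0
    norm_num  at this
    exact this
  have c₀ : c 0 = 0 := by
    have := hev 1 0 1 0 0
    norm_num [c₆, c₇, c₈] at this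
    exact this
  have c₁ : c 1 = 0 := by
    have := hev 1 0 0 1 0
    norm_num [c₆, c₇, c₈] at this
    exact this
  have c₂ : c 2 = 0 := by
    have := hev 1 0 0 0 1
    norm_num [c₆, c₇, c₈] at this
    exact this
  have c₃ : c 3 = 0 := by
    have := hev 0 1 0 1 0
    norm_num [c₆, c₇, c₈] at this
    exact this
  have c₄ : c 4 = 0 := by
    have := hev 0 1 0 0 1
    norm_num [c₆, c₇, c₈] at this
    exact this
  have c₅ : c 5 = 0 := by
    have := hev 0 0 1 0 1
    norm_num [c₆, c₇, c₈] at this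
    exact this
  intro i
  fin_cases i
  · exact c₀
  · exact c₁
  · exact c₂
  · exact c₃
  · exact c₄
  · exact c₅
  · exact c₆
  · exact c₇
  · exact c₈

end SL6

end

theorem lemma5p1 :
    SL6.P0 = Submodule.span ℂ (Set.range SL6.p) ∧
      LinearIndependent ℂ SL6.p ∧
      Module.finrank ℂ SL6.P0 = 9 := by
  have hspan : SL6.P0 = Submodule.span ℂ (Set.range SL6.p) :=
    le_antisymm SL6.P0_le_span (Submodule.span_le.2 (Set.range_subset_iff.2 SL6.p_mem_P0))
  refine ⟨hspan, SL6.linearIndependent_p, ?_⟩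
  rw [hspan, finrank_span_eq_card SL6.linearIndependent_p, Fintype.card_fin]
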